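/- Let $\mathbb{K}$ be $\mathbb{R}$ or $\mathbb{C}$, let $n\ge 0$ be an integer, let $A_{-1}\in\mathbb{K}^{n\times n}$, and let $A_2,A_3$ be $n\times n$ matrix functions on $(-1,0)$ with entries in $L_2(-1,0;\mathbb{K})$. Let $M_2=\mathbb{K}^n\times L_2(-1,0;\mathbb{K}^n)$ be the product Hilbert space, with norm $\|(v,\varphi)\|^2=\|v\|^2+\|\varphi\|_{L_2}^2$, and let $H^1=H^1([-1,0];\mathbb{K}^n)$. Let $\mathcal{A}$ be the operator in $M_2$ with $$D(\mathcal{A})=\{(v,\varphi):\ \varphi\in H^1,\ v=\varphi(0)-A_{-1}\varphi(-1)\},\qquad \mathcal{A}(v,\varphi)=\Bigl(\int_{-1}^0[A_2(\theta)\varphi'(\theta)+A_3(\theta)\varphi(\theta)]\,d\theta,\ \varphi'\Bigr).$$ Let $\tilde{\mathcal{A}}$ be the operator in $M_2$ defined, with $r(\theta)=\psi(\theta)+A_2(\theta)w$, by $$D(\tilde{\mathcal{A}})=\{(w,\psi)\in M_2:\ r\in H^1,\ A_{-1}r(0)=r(-1)\},\qquad \tilde{\mathcal{A}}(w,\psi)=\bigl(r(0),\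 -r'+A_3(\cdot)w\bigr).$$ Let $F:D(\mathcal{A})\to M_2$ be the linear operator $F(v,z)=(w(0),\psi)$, where $w(s)=z(s-1)$ for $s\in[0,1]$ and, for a.e. $\theta\in(-1,0)$, $$\psi(\theta)=\dot w(-\theta)+\int_0^\theta\bigl[A_2(\tau)\dot w(\tau-\theta)+A_3(\tau)w(\tau-\theta)\bigr]\,d\tau-A_2(\theta)w(0).$$ Then for every $\lambda\in\mathbb{K}$ with $\lambda\notin\sigma(\tilde{\mathcal{A}})$ (that is, $\lambda I-\tilde{\mathcal{A}}:D(\tilde{\mathcal{A}})\to M_2$ has a bounded two-sided inverse $(\lambda I-\tilde{\mathcal{A}})^{-1}$ on $M_2$) there are constants $c,C>0$ such that for all $x\in D(\mathcal{A})$ $$c\,\|x\|\ \le\ \bigl\|(\lambda I-\tilde{\mathcal{A}})^{-1}Fx\bigr\|\ \le\ C\,\|x\|,$$ where $\|\cdot\|$ is the norm of $M_2$. -/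

import Mathlib

open MeasureTheory Set

noncomputable section

namespace NeutralDelay

section Spaces

variable (𝕜 : Type*) [RCLike 𝕜] (n : ℕ)

/-- The Euclidean space `𝕜ⁿ`. -/
abbrev Vec : Type _ := EuclideanSpace 𝕜 (Fin n)

/-- Lebesgue measure on the interval `(-1, 0)`. -/
abbrev intervalMeasure : Measure ℝ := volume.restrict (Ioo (-1 : ℝ) 0)

/-- The space `L₂(-1, 0; 𝕜ⁿ)`. -/
abbrev L2 : Type _ := Lp (Vec 𝕜 n) 2 intervalMeasure

/-- The product Hilbert space `M₂ = 𝕜ⁿ × L₂(-1, 0; 𝕜ⁿ)`, with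
`‖(v, φ)‖² = ‖v‖² + ‖φ‖²`. -/
abbrev M2 : Type _ := WithLp 2 (Vec 𝕜 n × L2 𝕜 n)

end Spaces

section Pairs

variable {𝕜 : Type*} [RCLike 𝕜] {n : ℕ}

lemma pair_add (a c : Vec 𝕜 n) (b d : L2 𝕜 n) :
    (WithLp.toLp 2 (a, b) + WithLp.toLp 2 (c, d) : M2 𝕜 n) = WithLp.toLp 2 (a + c, b + d) := rfl

lemma pair_smul (s : 𝕜) (a : Vec 𝕜 n) (b : L2 𝕜 n) :
    (s • WithLp.toLp 2 (a, b) : M2 𝕜 n) = WithLp.toLp 2 (s • a, s • b) := rfl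

end Pairs

section Sobolev

variable {𝕜 : Type*} [RCLike 𝕜] {n : ℕ}

/-- The absolutely continuous function `θ ↦ c + ∫₀^θ g(s) ds`, `θ ∈ [-1, 0]`, with value `c` at
`0` and derivative `g`. -/
def primitive (c : Vec 𝕜 n) (g : L2 𝕜 n) (θ : ℝ) : Vec 𝕜 n :=
  c + ∫ s in (0 : ℝ)..θ, g s

lemma L2.intervalIntegrable (g : L2 𝕜 n) {θ : ℝ} (hθ : θ ∈ Icc (-1 : ℝ) 0) :
    IntervalIntegrable g volume 0 θ := by
  have h : Integrable g intervalMeasure := (Lp.memLp g).integrable (by norm_num)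
  rw [intervalIntegrable_iff, uIoc_of_ge hθ.2, ← integrableOn_Icc_iff_integrableOn_Ioc,
    integrableOn_Icc_iff_integrableOn_Ioo]
  exact IntegrableOn.mono_set h (Ioo_subset_Ioo_left hθ.1)

lemma intervalIntegral_congr_L2 {f g : ℝ → Vec 𝕜 n} (h : f =ᵐ[intervalMeasure] g) {θ : ℝ}
    (hθ : θ ∈ Icc (-1 : ℝ) 0) : ∫ s in (0 : ℝ)..θ, f s = ∫ s in (0 : ℝ)..θ, g s := by
  refine intervalIntegral.integral_congr_ae_restrict ?_
  rw [uIoc_of_ge hθ.2, ← Measure.restrict_congr_set Ioo_ae_eq_Ioc]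
  exact ae_restrict_of_ae_restrict_of_subset (Ioo_subset_Ioo_left hθ.1) h

lemma primitive_add (c d : Vec 𝕜 n) (g h : L2 𝕜 n) {θ : ℝ} (hθ : θ ∈ Icc (-1 : ℝ) 0) :
    primitive (c + d) (g + h) θ = primitive c g θ + primitive d h θ := by
  unfold primitive
  rw [intervalIntegral_congr_L2 (Lp.coeFn_add g h) hθ]
  simp only [Pi.add_apply]
  rw [intervalIntegral.integral_add (L2.intervalIntegrable g hθ) (L2.intervalIntegrable h hθ)]
  abel

lemma primitive_smul (a : 𝕜) (c : Vec 𝕜 n) (g : L2 𝕜 n) {θ : ℝ} (hθ : θ ∈ Icc (-1 : ℝ) 0) :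
    primitive (a • c) (a • g) θ = a • primitive c g θ := by
  unfold primitive
  rw [intervalIntegral_congr_L2 (Lp.coeFn_smul a g) hθ]
  simp only [Pi.smul_apply]
  rw [intervalIntegral.integral_smul, smul_add]

lemma continuousOn_primitive (c : Vec 𝕜 n) (g : L2 𝕜 n) :
    ContinuousOn (primitive c g) (Icc (-1) 0) := by
  have h := (L2.intervalIntegrable g (θ := -1) (by simp)).symm
  have h2 := intervalIntegral.continuousOn_primitive_interval' h (b₁ := -1) (b₂ := 0) (a := 0)
    (by simp)
  rw [uIcc_of_le (by norm_num)] at h2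
  exact continuousOn_const.add h2

lemma memLp_primitive (c : Vec 𝕜 n) (g : L2 𝕜 n) :
    MemLp (primitive c g) 2 intervalMeasure := by
  have hc := continuousOn_primitive c g
  obtain ⟨C, hC⟩ := isCompact_Icc.exists_bound_of_continuousOn hc
  refine MemLp.of_bound ((hc.mono Ioo_subset_Icc_self).aestronglyMeasurable measurableSet_Ioo) C ?_
  filter_upwards [ae_restrict_mem measurableSet_Ioo] with x hx
  exact hC x (Ioo_subset_Icc_self hx)

/-- The linear map `(c, g) ↦ (θ ↦ c + ∫₀^θ g(s) ds)` into `L₂(-1, 0; 𝕜ⁿ)`. -/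
def primitiveL2 : (Vec 𝕜 n × L2 𝕜 n) →ₗ[𝕜] L2 𝕜 n where
  toFun p := (memLp_primitive p.1 p.2).toLp _
  map_add' p q := by
    rw [← MemLp.toLp_add, MemLp.toLp_eq_toLp_iff]
    filter_upwards [ae_restrict_mem measurableSet_Ioo] with x hx
    exact primitive_add _ _ _ _ (Ioo_subset_Icc_self hx)
  map_smul' a p := by
    rw [RingHom.id_apply, ← MemLp.toLp_const_smul, MemLp.toLp_eq_toLp_iff]
    filter_upwards [ae_restrict_mem measurableSet_Ioo] with x hx
    exact primitive_smul _ _ _ (Ioo_subset_Icc_self hx)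

lemma primitiveL2_injective :
    Function.Injective (primitiveL2 : (Vec 𝕜 n × L2 𝕜 n) →ₗ[𝕜] L2 𝕜 n) := by
  rw [← LinearMap.ker_eq_bot, LinearMap.ker_eq_bot']
  rintro ⟨c, g⟩ h
  have h1 : primitive c g =ᵐ[intervalMeasure] fun _ => 0 := by
    have h2 := (memLp_primitive c g).coeFn_toLp
    have h3 : (memLp_primitive c g).toLp _ = (0 : L2 𝕜 n) := h
    rw [h3] at h2
    exact h2.symm.trans (Lp.coeFn_zero _ _ _)
  have h4 : EqOn (primitive c g) (fun _ => 0) (Icc (-1) 0) := by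
    refine Measure.eqOn_Icc_of_ae_eq volume (by norm_num) ?_ (continuousOn_primitive c g)
      continuousOn_const
    rwa [← Measure.restrict_congr_set Ioo_ae_eq_Icc]
  have hc : c = 0 := by
    have := h4 (x := 0) (by simp)
    simpa [primitive] using this
  have hg : ∀ θ ∈ Icc (-1 : ℝ) 0, ∫ s in (0 : ℝ)..θ, g s = 0 := by
    intro θ hθ
    have := h4 hθ
    simpa [primitive, hc] using this
  have hg0 : g = 0 := by
    rw [Lp.eq_zero_iff_ae_eq_zero]
    have hd := (L2.intervalIntegrable g (θ := -1) (by simp)).ae_hasDerivAt_integral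
    rw [Filter.EventuallyEq, ae_restrict_iff' measurableSet_Ioo]
    filter_upwards [hd] with x hx hxI
    have hx' := hx (by rw [uIcc_of_ge (by norm_num)]; exact Ioo_subset_Icc_self hxI) 0 (by simp)
    have h0 : (fun u => ∫ s in (0 : ℝ)..u, g s) =ᶠ[nhds x] fun _ => 0 := by
      filter_upwards [Ioo_mem_nhds hxI.1 hxI.2] with u hu
      exact hg u (Ioo_subset_Icc_self hu)
    exact hx'.unique ((hasDerivAt_const x (0 : Vec 𝕜 n)).congr_of_eventuallyEq h0)
  rw [hc, hg0]
  rfl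

variable (𝕜 n) in
/-- The Sobolev space `H¹([-1, 0]; 𝕜ⁿ)`: the classes `φ ∈ L₂` which have an absolutely continuous
representative with derivative in `L₂`, i.e. `φ(θ) = c + ∫₀^θ g(s) ds` for a.e. `θ ∈ (-1, 0)`,
with `c ∈ 𝕜ⁿ` and `g ∈ L₂`. -/
def H1 : Submodule 𝕜 (L2 𝕜 n) := LinearMap.range (primitiveL2 (𝕜 := 𝕜) (n := n))

/-- The pair (value at `0`, derivative), which determines an element of `H¹`. -/
def H1.data : H1 𝕜 n ≃ₗ[𝕜] Vec 𝕜 n × L2 𝕜 n :=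
  (LinearEquiv.ofInjective primitiveL2 primitiveL2_injective).symm

/-- The derivative `φ' ∈ L₂` of `φ ∈ H¹`. -/
def H1.deriv : H1 𝕜 n →ₗ[𝕜] L2 𝕜 n := LinearMap.snd 𝕜 _ _ ∘ₗ H1.data.toLinearMap

/-- The value `φ(θ)` at `θ ∈ [-1, 0]` of the continuous representative of `φ ∈ H¹`. -/
def H1.eval (θ : Icc (-1 : ℝ) 0) : H1 𝕜 n →ₗ[𝕜] Vec 𝕜 n where
  toFun φ := primitive (H1.data φ).1 (H1.data φ).2 θ
  map_add' φ ψ := by rw [map_add]; exact primitive_add _ _ _ _ θ.2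
  map_smul' a φ := by rw [map_smul]; exact primitive_smul _ _ _ θ.2

/-- The value `φ(0)` of `φ ∈ H¹`. -/
def H1.evalZero : H1 𝕜 n →ₗ[𝕜] Vec 𝕜 n := H1.eval ⟨0, by norm_num⟩

/-- The value `φ(-1)` of `φ ∈ H¹`. -/
def H1.evalNegOne : H1 𝕜 n →ₗ[𝕜] Vec 𝕜 n := H1.eval ⟨-1, by norm_num⟩

end Sobolev

/-- The coefficients of the neutral type equation
`z'(t) = A₁ z'(t-1) + ∫_{-1}^0 [A₂(θ) z'(t+θ) + A₃(θ) z(t+θ)] dθ` (the constant matrix, usually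
written `A_{-1}`, is called `A₁` here): `n × n` matrices, the entries of `A₂`, `A₃` being in
`L₂(-1, 0)`. -/
structure System (𝕜 : Type*) [RCLike 𝕜] (n : ℕ) where
  A₁ : Matrix (Fin n) (Fin n) 𝕜
  A₂ : ℝ → Matrix (Fin n) (Fin n) 𝕜
  A₃ : ℝ → Matrix (Fin n) (Fin n) 𝕜
  memLp_A₂ : ∀ i j, MemLp (fun θ => A₂ θ i j) 2 intervalMeasure
  memLp_A₃ : ∀ i j, MemLp (fun θ => A₃ θ i j) 2 intervalMeasure

section Matrices

variable {𝕜 : Type*} [RCLike 𝕜] {n : ℕ}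

/-- A matrix acting on the Euclidean space `𝕜ⁿ`. -/
abbrev act (A : Matrix (Fin n) (Fin n) 𝕜) : Vec 𝕜 n →L[𝕜] Vec 𝕜 n :=
  Matrix.toEuclideanCLM (n := Fin n) (𝕜 := 𝕜) A

lemma memLp_sum_smul {X : Type*} [NormedAddCommGroup X] [NormedSpace 𝕜 X]
    {a : ℝ → Fin n → Fin n → 𝕜} (C : Fin n → Fin n → X)
    (ha : ∀ i j, MemLp (fun θ => a θ i j) 2 intervalMeasure) :
    MemLp (fun θ => ∑ i, ∑ j, a θ i j • C i j) 2 intervalMeasure := by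
  refine memLp_finsetSum _ fun i _ => memLp_finsetSum _ fun j _ => ?_
  exact ((ContinuousLinearMap.id 𝕜 𝕜).smulRight (C i j)).comp_memLp' (ha i j)

lemma memLp_act {A : ℝ → Matrix (Fin n) (Fin n) 𝕜}
    (hA : ∀ i j, MemLp (fun θ => A θ i j) 2 intervalMeasure) :
    MemLp (fun θ => act (A θ)) 2 intervalMeasure := by
  have h : (fun θ => act (A θ)) =
      fun θ => ∑ i, ∑ j, (A θ i j) • act (Matrix.single i j (1 : 𝕜)) := by
    funext θ
    conv_lhs => rw [Matrix.matrix_eq_sum_single (A θ)]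
    simp only [act, map_sum]
    refine Finset.sum_congr rfl fun i _ => Finset.sum_congr rfl fun j _ => ?_
    rw [← map_smul, Matrix.smul_single, smul_eq_mul, mul_one]
  rw [h]
  exact memLp_sum_smul (fun i j => act (Matrix.single i j (1 : 𝕜))) hA

lemma aestronglyMeasurable_apply {α : Type*} [MeasurableSpace α] {ν : Measure α}
    {A : α → (Vec 𝕜 n →L[𝕜] Vec 𝕜 n)} {b : α → Vec 𝕜 n} (hA : AEStronglyMeasurable A ν)
    (hb : AEStronglyMeasurable b ν) : AEStronglyMeasurable (fun x => A x (b x)) ν :=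
  isBoundedBilinearMap_apply.continuous.comp_aestronglyMeasurable (hA.prodMk hb)

lemma norm_apply_le (A : Vec 𝕜 n →L[𝕜] Vec 𝕜 n) (b : Vec 𝕜 n) :
    ‖A b‖ ≤ ‖A‖ ^ 2 + ‖b‖ ^ 2 := by
  have h := A.le_opNorm b
  nlinarith [sq_nonneg (‖A‖ - ‖b‖), sq_nonneg ‖A‖, sq_nonneg ‖b‖]

lemma integrable_apply {ν : Measure ℝ} {A : ℝ → (Vec 𝕜 n →L[𝕜] Vec 𝕜 n)} {b : ℝ → Vec 𝕜 n}
    (hA : MemLp A 2 ν) (hb : MemLp b 2 ν) : Integrable (fun x => A x (b x)) ν := by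
  refine Integrable.mono' (g := fun x => ‖A x‖ ^ 2 + ‖b x‖ ^ 2) ?_
    (aestronglyMeasurable_apply hA.1 hb.1) (Filter.Eventually.of_forall fun x => norm_apply_le _ _)
  exact (hA.integrable_norm_pow (by norm_num)).add (hb.integrable_norm_pow (by norm_num))

lemma memLp_act_apply {A : ℝ → Matrix (Fin n) (Fin n) 𝕜}
    (hA : ∀ i j, MemLp (fun θ => A θ i j) 2 intervalMeasure) (w : Vec 𝕜 n) :
    MemLp (fun θ => act (A θ) w) 2 intervalMeasure :=
  (ContinuousLinearMap.apply 𝕜 (Vec 𝕜 n) w).comp_memLp' (memLp_act hA)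

/-- `θ ↦ A(θ) w` as an element of `L₂`. -/
def mulL2 (A : ℝ → Matrix (Fin n) (Fin n) 𝕜)
    (hA : ∀ i j, MemLp (fun θ => A θ i j) 2 intervalMeasure) : Vec 𝕜 n →ₗ[𝕜] L2 𝕜 n where
  toFun w := (memLp_act_apply hA w).toLp _
  map_add' v w := by
    rw [← MemLp.toLp_add, MemLp.toLp_eq_toLp_iff]
    exact Filter.Eventually.of_forall fun θ => map_add _ _ _
  map_smul' a v := by
    rw [RingHom.id_apply, ← MemLp.toLp_const_smul, MemLp.toLp_eq_toLp_iff]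
    exact Filter.Eventually.of_forall fun θ => map_smul _ _ _

end Matrices

section Convolution

variable {𝕜 : Type*} [RCLike 𝕜] {n : ℕ}

lemma measurePreserving_reflect :
    MeasurePreserving (fun θ : ℝ => -1 - θ) intervalMeasure intervalMeasure := by
  have h0 : MeasurePreserving (fun θ : ℝ => -1 - θ) volume volume := by
    simp_rw [sub_eq_add_neg]
    exact (measurePreserving_add_left volume (-1 : ℝ)).comp (Measure.measurePreserving_neg volume)
  have h := h0.restrict_preimage (measurableSet_Ioo (a := (-1 : ℝ)) (b := 0))
  have hs : (fun θ : ℝ => -1 - θ) ⁻¹' Ioo (-1) 0 = Ioo (-1) 0 := by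
    ext x
    simp only [mem_preimage, mem_Ioo]
    constructor <;> rintro ⟨h1, h2⟩ <;> constructor <;> linarith
  rw [hs] at h
  exact h

lemma reflect_congr {X : Type*} {b b' : ℝ → X} (h : b =ᵐ[intervalMeasure] b') :
    ∀ᵐ θ ∂intervalMeasure, b (-1 - θ) = b' (-1 - θ) :=
  measurePreserving_reflect.quasiMeasurePreserving.ae h

lemma memLp_reflect {b : ℝ → Vec 𝕜 n} (hb : MemLp b 2 intervalMeasure) :
    MemLp (fun θ => b (-1 - θ)) 2 intervalMeasure :=
  hb.comp_measurePreserving measurePreserving_reflect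

lemma measurePreserving_shift (θ : ℝ) :
    MeasurePreserving (fun τ : ℝ => τ - θ - 1) (volume.restrict (Ioo θ 0))
      (volume.restrict (Ioo (-1) (-1 - θ))) := by
  have h := (measurePreserving_sub_right (volume : Measure ℝ) (θ + 1)).restrict_preimage
    (measurableSet_Ioo (a := (-1 : ℝ)) (b := -1 - θ))
  have hs : (fun τ : ℝ => τ - (θ + 1)) ⁻¹' Ioo (-1) (-1 - θ) = Ioo θ 0 := by
    ext x
    simp only [mem_preimage, mem_Ioo]
    constructor <;> rintro ⟨h1, h2⟩ <;> constructor <;> linarith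
  rw [hs] at h
  convert h using 2
  ring

lemma memLp_shift {b : ℝ → Vec 𝕜 n} (hb : MemLp b 2 intervalMeasure) {θ : ℝ}
    (hθ : θ ∈ Icc (-1 : ℝ) 0) :
    MemLp (fun τ => b (τ - θ - 1)) 2 (volume.restrict (Ioo θ 0)) := by
  have h : MemLp b 2 (volume.restrict (Ioo (-1) (-1 - θ))) :=
    hb.mono_measure (Measure.restrict_mono_set _ (Ioo_subset_Ioo_right (by linarith [hθ.1])))
  exact h.comp_measurePreserving (measurePreserving_shift θ)

lemma integrable_conv {A : ℝ → (Vec 𝕜 n →L[𝕜] Vec 𝕜 n)} {b : ℝ → Vec 𝕜 n}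
    (hA : MemLp A 2 intervalMeasure) (hb : MemLp b 2 intervalMeasure) {θ : ℝ}
    (hθ : θ ∈ Icc (-1 : ℝ) 0) :
    IntervalIntegrable (fun τ => A τ (b (τ - θ - 1))) volume 0 θ := by
  rw [intervalIntegrable_iff, uIoc_of_ge hθ.2, IntegrableOn,
    ← Measure.restrict_congr_set Ioo_ae_eq_Ioc]
  exact integrable_apply
    (hA.mono_measure (Measure.restrict_mono_set _ (Ioo_subset_Ioo_left hθ.1))) (memLp_shift hb hθ)

lemma memLp_conv {A : ℝ → (Vec 𝕜 n →L[𝕜] Vec 𝕜 n)} {b : ℝ → Vec 𝕜 n}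
    (hA : MemLp A 2 intervalMeasure) (hb : MemLp b 2 intervalMeasure) :
    MemLp (fun θ => ∫ τ in (0 : ℝ)..θ, A τ (b (τ - θ - 1))) 2 intervalMeasure := by
  obtain ⟨b', hb'm, hbb'⟩ := hb.1
  have hmeas : AEStronglyMeasurable
      (fun p : ℝ × ℝ => {q : ℝ × ℝ | q.1 < q.2}.indicator
        (fun p : ℝ × ℝ => A p.2 (b' (p.2 - p.1 - 1))) p)
      (intervalMeasure.prod intervalMeasure) := by
    refine AEStronglyMeasurable.indicator ?_ (measurableSet_lt measurable_fst measurable_snd)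
    refine aestronglyMeasurable_apply hA.1.comp_snd ?_
    exact (hb'm.comp_measurable (by fun_prop)).aestronglyMeasurable
  have hint := hmeas.integral_prod_right'
  have hae : (fun θ => ∫ τ in (0 : ℝ)..θ, A τ (b (τ - θ - 1))) =ᵐ[intervalMeasure]
      fun θ => -∫ τ, {q : ℝ × ℝ | q.1 < q.2}.indicator
        (fun p : ℝ × ℝ => A p.2 (b' (p.2 - p.1 - 1))) (θ, τ) ∂intervalMeasure := by
    filter_upwards [ae_restrict_mem measurableSet_Ioo] with θ hθ
    have hθ' := Ioo_subset_Icc_self hθ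
    have hset : (fun τ => {q : ℝ × ℝ | q.1 < q.2}.indicator
        (fun p : ℝ × ℝ => A p.2 (b' (p.2 - p.1 - 1))) (θ, τ)) =
        (Ioi θ).indicator (fun τ => A τ (b' (τ - θ - 1))) := by
      funext τ
      by_cases h : θ < τ <;> simp [indicator, h]
    rw [intervalIntegral.integral_symm, intervalIntegral.integral_of_le hθ.2.le, hset,
      integral_indicator measurableSet_Ioi, Measure.restrict_restrict measurableSet_Ioi]
    have h1 : Ioi θ ∩ Ioo (-1) 0 = Ioo θ 0 := by
      ext x
      simp only [mem_inter_iff, mem_Ioi, mem_Ioo]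
      constructor
      · rintro ⟨h1, h2, h3⟩; exact ⟨h1, h3⟩
      · rintro ⟨h1, h2⟩; exact ⟨h1, by linarith [hθ.1], h2⟩
    rw [h1, ← Measure.restrict_congr_set Ioo_ae_eq_Ioc]
    congr 1
    refine integral_congr_ae ?_
    have h2 : b =ᵐ[volume.restrict (Ioo (-1) (-1 - θ))] b' :=
      ae_restrict_of_ae_restrict_of_subset (Ioo_subset_Ioo_right (by linarith [hθ.1])) hbb'
    filter_upwards [(measurePreserving_shift θ).quasiMeasurePreserving.ae h2] with τ hτ
    rw [hτ]
  refine MemLp.of_bound ((hint.neg).congr hae.symm)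
    ((∫ τ, ‖A τ‖ ^ 2 ∂intervalMeasure) + ∫ τ, ‖b τ‖ ^ 2 ∂intervalMeasure) ?_
  filter_upwards [ae_restrict_mem measurableSet_Ioo] with θ hθ
  have hθ' := Ioo_subset_Icc_self hθ
  have iA : Integrable (fun τ => ‖A τ‖ ^ 2) intervalMeasure :=
    hA.integrable_norm_pow (by norm_num)
  have ib : Integrable (fun τ => ‖b τ‖ ^ 2) intervalMeasure :=
    hb.integrable_norm_pow (by norm_num)
  have iA' : Integrable (fun τ => ‖A τ‖ ^ 2) (volume.restrict (Ioo θ 0)) :=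
    iA.mono_measure (Measure.restrict_mono_set _ (Ioo_subset_Ioo_left hθ.1.le))
  have ib' : Integrable (fun τ => ‖b (τ - θ - 1)‖ ^ 2) (volume.restrict (Ioo θ 0)) :=
    (memLp_shift hb hθ').integrable_norm_pow (by norm_num)
  rw [intervalIntegral.integral_symm, norm_neg, intervalIntegral.integral_of_le hθ.2.le,
    ← Measure.restrict_congr_set Ioo_ae_eq_Ioc]
  refine (norm_integral_le_of_norm_le (iA'.add ib')
    (Filter.Eventually.of_forall fun τ => norm_apply_le _ _)).trans ?_
  rw [integral_add' iA' ib']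
  refine add_le_add ?_ ?_
  · exact integral_mono_measure (Measure.restrict_mono_set _ (Ioo_subset_Ioo_left hθ.1.le))
      (Filter.Eventually.of_forall fun τ => by positivity) iA
  · have h3 : ∫ τ in Ioo θ 0, ‖b (τ - θ - 1)‖ ^ 2 = ∫ τ in Ioo (-1) (-1 - θ), ‖b τ‖ ^ 2 := by
      have hemb : MeasurableEmbedding (fun τ : ℝ => τ - θ - 1) := by
        have := (Homeomorph.subRight (θ + 1)).measurableEmbedding
        convert this using 1
        funext τ
        simp only [Homeomorph.coe_subRight]
        ring
      exact (measurePreserving_shift θ).integral_comp hemb (fun τ => ‖b τ‖ ^ 2)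
    rw [h3]
    exact integral_mono_measure
      (Measure.restrict_mono_set _ (Ioo_subset_Ioo_right (by linarith [hθ.1])))
      (Filter.Eventually.of_forall fun τ => by positivity) ib

end Convolution

section Resolvent

variable {𝕜 : Type*} [RCLike 𝕜] {X : Type*} [NormedAddCommGroup X] [NormedSpace 𝕜 X]

/-- The bounded operator `R` is a two-sided inverse of `lam I - T : D(T) → X`. -/
def IsResolventAt (T : X →ₗ.[𝕜] X) (lam : 𝕜) (R : X →L[𝕜] X) : Prop :=
  (∀ y : X, ∃ h : R y ∈ T.domain, lam • R y - T ⟨R y, h⟩ = y) ∧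
    ∀ x : T.domain, R (lam • (x : X) - T x) = x

/-- The spectrum of the (unbounded) operator `T`: the `lam` for which `lam I - T : D(T) → X` has no
bounded inverse. -/
def opSpectrum (T : X →ₗ.[𝕜] X) : Set 𝕜 := {lam | ¬ ∃ R : X →L[𝕜] X, IsResolventAt T lam R}

open Classical in
/-- The resolvent `(lam I - T)⁻¹`, for `lam` outside of the spectrum of `T` (and `0` otherwise). -/
def resolventOp (T : X →ₗ.[𝕜] X) (lam : 𝕜) : X →L[𝕜] X :=
  if h : ∃ R : X →L[𝕜] X, IsResolventAt T lam R then h.choose else 0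

end Resolvent

namespace System

variable {𝕜 : Type*} [RCLike 𝕜] {n : ℕ} (S : System 𝕜 n)

/-- `L f = ∫_{-1}^0 [A₂(θ) f'(θ) + A₃(θ) f(θ)] dθ` for `f ∈ H¹`. -/
def L : H1 𝕜 n →ₗ[𝕜] Vec 𝕜 n where
  toFun f := ∫ θ, (act (S.A₂ θ) (H1.deriv f θ) + act (S.A₃ θ) ((f : L2 𝕜 n) θ)) ∂intervalMeasure
  map_add' f g := by
    have i2 (u : L2 𝕜 n) := integrable_apply (memLp_act S.memLp_A₂) (Lp.memLp u)
    have i3 (u : L2 𝕜 n) := integrable_apply (memLp_act S.memLp_A₃) (Lp.memLp u)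
    refine Eq.trans (integral_congr_ae ?_) (integral_add ((i2 (H1.deriv f)).add (i3 f))
      ((i2 (H1.deriv g)).add (i3 g)))
    filter_upwards [Lp.coeFn_add (H1.deriv f) (H1.deriv g), Lp.coeFn_add (f : L2 𝕜 n) g]
      with θ h1 h2
    rw [map_add, Submodule.coe_add, h1, h2, Pi.add_apply, Pi.add_apply, map_add, map_add]
    abel
  map_smul' a f := by
    rw [RingHom.id_apply, ← integral_smul]
    refine integral_congr_ae ?_
    filter_upwards [Lp.coeFn_smul a (H1.deriv f), Lp.coeFn_smul a (f : L2 𝕜 n)] with θ h1 h2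
    rw [map_smul, Submodule.coe_smul, h1, h2, Pi.smul_apply, Pi.smul_apply, map_smul, map_smul,
      smul_add]

/-- `D(A) = {(v, φ) : φ ∈ H¹, v = φ(0) - A₁ φ(-1)}`. -/
def domA : Submodule 𝕜 (M2 𝕜 n) where
  carrier := {x | ∃ h : x.snd ∈ H1 𝕜 n,
    x.fst = H1.evalZero ⟨x.snd, h⟩ - act S.A₁ (H1.evalNegOne ⟨x.snd, h⟩)}
  zero_mem' := ⟨(H1 𝕜 n).zero_mem, by
    change (0 : Vec 𝕜 n) = H1.evalZero (0 : H1 𝕜 n) - act S.A₁ (H1.evalNegOne (0 : H1 𝕜 n))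
    simp⟩
  add_mem' := by
    rintro x y ⟨hx, hx'⟩ ⟨hy, hy'⟩
    refine ⟨(H1 𝕜 n).add_mem hx hy, ?_⟩
    change x.fst + y.fst = H1.evalZero (⟨x.snd, hx⟩ + ⟨y.snd, hy⟩ : H1 𝕜 n) -
      act S.A₁ (H1.evalNegOne (⟨x.snd, hx⟩ + ⟨y.snd, hy⟩ : H1 𝕜 n))
    rw [hx', hy', map_add, map_add, map_add]
    abel
  smul_mem' := by
    rintro a x ⟨hx, hx'⟩
    refine ⟨(H1 𝕜 n).smul_mem a hx, ?_⟩
    change a • x.fst = H1.evalZero (a • ⟨x.snd, hx⟩ : H1 𝕜 n) -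
      act S.A₁ (H1.evalNegOne (a • ⟨x.snd, hx⟩ : H1 𝕜 n))
    rw [hx', map_smul, map_smul, map_smul, smul_sub]

/-- The second component of `(v, φ) ∈ D(A)`, as an element of `H¹`. -/
def history : S.domA →ₗ[𝕜] H1 𝕜 n where
  toFun x := ⟨(x : M2 𝕜 n).snd, x.2.1⟩
  map_add' _ _ := rfl
  map_smul' _ _ := rfl

/-- The operator `A (v, φ) = (L φ, φ')` in `M₂` with domain `D(A)`. -/
abbrev opA : M2 𝕜 n →ₗ.[𝕜] M2 𝕜 n where
  domain := S.domA
  toFun :=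
    { toFun := fun x => WithLp.toLp 2 (S.L (S.history x), H1.deriv (S.history x))
      map_add' := fun x y => by simp only [map_add]; rfl
      map_smul' := fun a x => by simp only [map_smul]; rfl }

/-- The linear map `(w, ψ) ↦ r = ψ + A₂(·) w`. -/
def rMap : M2 𝕜 n →ₗ[𝕜] L2 𝕜 n where
  toFun x := x.snd + mulL2 S.A₂ S.memLp_A₂ x.fst
  map_add' x y := by
    rw [WithLp.add_snd, WithLp.add_fst, map_add]
    abel
  map_smul' a x := by
    rw [WithLp.smul_snd, WithLp.smul_fst, map_smul, RingHom.id_apply, smul_add]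

/-- `D(Ã) = {(w, ψ) : r = ψ + A₂(·) w ∈ H¹, A₁ r(0) = r(-1)}`. -/
def domTilde : Submodule 𝕜 (M2 𝕜 n) where
  carrier := {x | ∃ h : S.rMap x ∈ H1 𝕜 n,
    act S.A₁ (H1.evalZero ⟨S.rMap x, h⟩) = H1.evalNegOne ⟨S.rMap x, h⟩}
  zero_mem' := by
    have h0 : S.rMap 0 ∈ H1 𝕜 n := by rw [map_zero]; exact (H1 𝕜 n).zero_mem
    have h1 : (⟨S.rMap 0, h0⟩ : H1 𝕜 n) = 0 := Subtype.ext (map_zero _)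
    exact ⟨h0, by rw [h1]; simp⟩
  add_mem' := by
    rintro x y ⟨hx, hx'⟩ ⟨hy, hy'⟩
    have h0 : S.rMap (x + y) ∈ H1 𝕜 n := by rw [map_add]; exact (H1 𝕜 n).add_mem hx hy
    have h1 : (⟨S.rMap (x + y), h0⟩ : H1 𝕜 n) = ⟨S.rMap x, hx⟩ + ⟨S.rMap y, hy⟩ :=
      Subtype.ext (map_add _ _ _)
    exact ⟨h0, by rw [h1, map_add, map_add, map_add, hx', hy']⟩
  smul_mem' := by
    rintro a x ⟨hx, hx'⟩
    have h0 : S.rMap (a • x) ∈ H1 𝕜 n := by rw [map_smul]; exact (H1 𝕜 n).smul_mem a hx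
    have h1 : (⟨S.rMap (a • x), h0⟩ : H1 𝕜 n) = a • ⟨S.rMap x, hx⟩ :=
      Subtype.ext (map_smul _ _ _)
    exact ⟨h0, by rw [h1, map_smul, map_smul, map_smul, hx']⟩

/-- The function `r = ψ + A₂(·) w` of `(w, ψ) ∈ D(Ã)`, as an element of `H¹`. -/
def rH1 : S.domTilde →ₗ[𝕜] H1 𝕜 n where
  toFun x := ⟨S.rMap x, x.2.1⟩
  map_add' x y := Subtype.ext (map_add S.rMap (x : M2 𝕜 n) y)
  map_smul' a x := Subtype.ext (map_smul S.rMap a (x : M2 𝕜 n))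

/-- The operator `Ã (w, ψ) = (r(0), -r' + A₃(·) w)`, `r = ψ + A₂(·) w`, in `M₂` with domain
`D(Ã)`. -/
def opTilde : M2 𝕜 n →ₗ.[𝕜] M2 𝕜 n where
  domain := S.domTilde
  toFun :=
    { toFun := fun x => WithLp.toLp 2 (H1.evalZero (S.rH1 x),
        -H1.deriv (S.rH1 x) + mulL2 S.A₃ S.memLp_A₃ (x : M2 𝕜 n).fst)
      map_add' := fun x y => by
        rw [map_add, map_add, map_add, Submodule.coe_add, WithLp.add_fst, map_add]
        rw [pair_add]
        congr 2
        abel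
      map_smul' := fun a x => by
        rw [map_smul, map_smul, map_smul, Submodule.coe_smul, WithLp.smul_fst, map_smul,
          RingHom.id_apply, pair_smul, smul_add, smul_neg] }

/-- For `z ∈ H¹([-1, 0])`, put `w(s) = z(s - 1)`, `s ∈ [0, 1]`. This is the function
`r(θ) = w'(-θ) + ∫₀^θ [A₂(τ) w'(τ - θ) + A₃(τ) w(τ - θ)] dτ`, `θ ∈ (-1, 0)`. -/
def rFun (z : H1 𝕜 n) (θ : ℝ) : Vec 𝕜 n :=
  H1.deriv z (-1 - θ) + ∫ τ in (0 : ℝ)..θ,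
    (act (S.A₂ τ) (H1.deriv z (τ - θ - 1)) + act (S.A₃ τ) ((z : L2 𝕜 n) (τ - θ - 1)))

lemma rFun_eq (z : H1 𝕜 n) {θ : ℝ} (hθ : θ ∈ Icc (-1 : ℝ) 0) :
    S.rFun z θ = H1.deriv z (-1 - θ) +
      ((∫ τ in (0 : ℝ)..θ, act (S.A₂ τ) (H1.deriv z (τ - θ - 1))) +
        ∫ τ in (0 : ℝ)..θ, act (S.A₃ τ) ((z : L2 𝕜 n) (τ - θ - 1))) := by
  rw [rFun, intervalIntegral.integral_add
    (integrable_conv (memLp_act S.memLp_A₂) (Lp.memLp (H1.deriv z)) hθ)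
    (integrable_conv (memLp_act S.memLp_A₃) (Lp.memLp (z : L2 𝕜 n)) hθ)]

lemma memLp_rFun (z : H1 𝕜 n) : MemLp (S.rFun z) 2 intervalMeasure := by
  refine MemLp.ae_eq ?_ ((memLp_reflect (Lp.memLp (H1.deriv z))).add
    ((memLp_conv (memLp_act S.memLp_A₂) (Lp.memLp (H1.deriv z))).add
      (memLp_conv (memLp_act S.memLp_A₃) (Lp.memLp (z : L2 𝕜 n)))))
  filter_upwards [ae_restrict_mem measurableSet_Ioo] with θ hθ
  exact (S.rFun_eq z (Ioo_subset_Icc_self hθ)).symm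

lemma conv_congr {A : ℝ → (Vec 𝕜 n →L[𝕜] Vec 𝕜 n)} {b b' : ℝ → Vec 𝕜 n}
    (h : b =ᵐ[intervalMeasure] b') {θ : ℝ} (hθ : θ ∈ Icc (-1 : ℝ) 0) :
    ∫ τ in (0 : ℝ)..θ, A τ (b (τ - θ - 1)) = ∫ τ in (0 : ℝ)..θ, A τ (b' (τ - θ - 1)) := by
  refine intervalIntegral.integral_congr_ae_restrict ?_
  rw [uIoc_of_ge hθ.2, ← Measure.restrict_congr_set Ioo_ae_eq_Ioc]
  have h2 : b =ᵐ[volume.restrict (Ioo (-1) (-1 - θ))] b' :=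
    ae_restrict_of_ae_restrict_of_subset (Ioo_subset_Ioo_right (by linarith [hθ.1])) h
  filter_upwards [(measurePreserving_shift θ).quasiMeasurePreserving.ae h2] with τ hτ
  rw [hτ]

/-- The class in `L₂(-1, 0; 𝕜ⁿ)` of the function `r` built from `z ∈ H¹`. -/
def rL2 : H1 𝕜 n →ₗ[𝕜] L2 𝕜 n where
  toFun z := (S.memLp_rFun z).toLp _
  map_add' z y := by
    rw [← MemLp.toLp_add, MemLp.toLp_eq_toLp_iff]
    have h1 : H1.deriv (z + y) =ᵐ[intervalMeasure] H1.deriv z + H1.deriv y := by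
      rw [map_add]; exact Lp.coeFn_add _ _
    have h2 : ((z + y : H1 𝕜 n) : L2 𝕜 n) =ᵐ[intervalMeasure] (z : L2 𝕜 n) + (y : L2 𝕜 n) :=
      Lp.coeFn_add _ _
    filter_upwards [ae_restrict_mem measurableSet_Ioo, reflect_congr h1] with θ hθ h3
    have hθ' := Ioo_subset_Icc_self hθ
    have i2 (u : L2 𝕜 n) := integrable_conv (memLp_act S.memLp_A₂) (Lp.memLp u) hθ'
    have i3 (u : L2 𝕜 n) := integrable_conv (memLp_act S.memLp_A₃) (Lp.memLp u) hθ'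
    rw [Pi.add_apply, S.rFun_eq _ hθ', S.rFun_eq _ hθ', S.rFun_eq _ hθ', h3,
      conv_congr h1 hθ', conv_congr h2 hθ']
    simp only [Pi.add_apply, map_add]
    rw [intervalIntegral.integral_add (i2 _) (i2 _), intervalIntegral.integral_add (i3 _) (i3 _)]
    abel
  map_smul' a z := by
    rw [RingHom.id_apply, ← MemLp.toLp_const_smul, MemLp.toLp_eq_toLp_iff]
    have h1 : H1.deriv (a • z) =ᵐ[intervalMeasure] a • H1.deriv z := by
      rw [map_smul]; exact Lp.coeFn_smul _ _
    have h2 : ((a • z : H1 𝕜 n) : L2 𝕜 n) =ᵐ[intervalMeasure] a • (z : L2 𝕜 n) :=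
      Lp.coeFn_smul _ _
    filter_upwards [ae_restrict_mem measurableSet_Ioo, reflect_congr h1] with θ hθ h3
    have hθ' := Ioo_subset_Icc_self hθ
    rw [Pi.smul_apply, S.rFun_eq _ hθ', S.rFun_eq _ hθ', h3, conv_congr h1 hθ', conv_congr h2 hθ']
    simp only [Pi.smul_apply, map_smul, smul_add, intervalIntegral.integral_smul]

/-- The operator `F : D(A) → M₂` between the initial conditions: with `w(s) = z(s - 1)` for
`s ∈ [0, 1]`, it sends `(v, z)`, where `v = z(0) - A₁ z(-1) = w(1) - A₁ w(0)`, to `(w(0), ψ)`,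
`ψ(θ) = r(θ) - A₂(θ) w(0)`, with
`r(θ) = w'(-θ) + ∫₀^θ [A₂(τ) w'(τ - θ) + A₃(τ) w(τ - θ)] dτ`. -/
def F : S.domA →ₗ[𝕜] M2 𝕜 n where
  toFun x := WithLp.toLp 2 (H1.evalNegOne (S.history x),
    S.rL2 (S.history x) - mulL2 S.A₂ S.memLp_A₂ (H1.evalNegOne (S.history x)))
  map_add' x y := by
    have h : S.history (x + y) = S.history x + S.history y := rfl
    rw [h, map_add, map_add, map_add, pair_add]
    congr 2
    abel
  map_smul' a x := by
    have h : S.history (a • x) = a • S.history x := rfl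
    rw [h, map_smul, map_smul, map_smul, RingHom.id_apply, pair_smul, smul_sub]

end System

end NeutralDelay

end

/-! `F x` contains `z'`, which the norm of `x = (v, z)` does not control, but this derivative sits
inside a term `Ã(0, g)`, where the resolvent absorbs it. Write `(A * b)(θ) = ∫₀^θ A(τ) b(τ - θ - 1)
dτ`, `k = v - ∫ A₂ z` and `g(θ) = z(-1 - θ) + (A₂ * z)(θ) + θ k`. For `x ∈ D(A)` the function `g`
lies in `H¹`, `(0, g) ∈ D(Ã)`, and `F x = f - (λ - Ã)(0, g)` with `f = (0, λ g + k + A₃ * z)`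
(`exists_gVec_mem`, `F_eq`). Hence `(λ - Ã)⁻¹ F x = (λ - Ã)⁻¹ f - (0, g)`.

Upper bound: `f` and `g` no longer contain a derivative, so both are bounded by a multiple of `‖x‖`.

Lower bound: let `(u, η) = (λ - Ã)⁻¹ F x`. Since `(u, η + g)` solves the resolvent equation with
right side `f`, the function `r = η + g + A₂ u` satisfies `r(0) = λ u` and `r' = -λ η + A₃ u + A₃ *
z + k`. On integrating, the terms `θ k` cancel, which leaves a Volterra equation `z(-1 - ·) + A₂ * z
- ∫₀ A₃ * z = (terms in u, η)`. A Gronwall argument (`exists_norm_le_volterra`) bounds `z`; the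
boundary condition `A₁ r(0) = r(-1)` then bounds `k`, and `v = k + ∫ A₂ z`. -/

namespace NeutralDelay

/-! ### Cauchy–Schwarz bounds for convolutions, integrals and primitives. -/

section Estimates

variable {𝕜 : Type*} [RCLike 𝕜] {n : ℕ}

lemma integral_mul_sq_le {ν : Measure ℝ} {f g : ℝ → ℝ} (hf : MemLp f 2 ν) (hg : MemLp g 2 ν)
    (hf0 : ∀ x, 0 ≤ f x) (hg0 : ∀ x, 0 ≤ g x) :
    (∫ x, f x * g x ∂ν) ^ 2 ≤ (∫ x, f x ^ 2 ∂ν) * ∫ x, g x ^ 2 ∂ν := by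
  have h := integral_mul_le_Lp_mul_Lq_of_nonneg (μ := ν) Real.HolderConjugate.two_two
    (Filter.Eventually.of_forall hf0) (Filter.Eventually.of_forall hg0)
    (by simpa using hf) (by simpa using hg)
  simp only [Real.rpow_two, ← Real.sqrt_eq_rpow] at h
  have hf2 : 0 ≤ ∫ x, f x ^ 2 ∂ν := integral_nonneg fun _ => by positivity
  have hg2 : 0 ≤ ∫ x, g x ^ 2 ∂ν := integral_nonneg fun _ => by positivity
  refine (pow_le_pow_left₀ (integral_nonneg fun x => mul_nonneg (hf0 x) (hg0 x)) h 2).trans ?_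
  rw [mul_pow, Real.sq_sqrt hf2, Real.sq_sqrt hg2]

lemma norm_integral_apply_sq_le {ν : Measure ℝ} {A : ℝ → (Vec 𝕜 n →L[𝕜] Vec 𝕜 n)}
    {b : ℝ → Vec 𝕜 n} (hA : MemLp A 2 ν) (hb : MemLp b 2 ν) :
    ‖∫ x, A x (b x) ∂ν‖ ^ 2 ≤ (∫ x, ‖A x‖ ^ 2 ∂ν) * ∫ x, ‖b x‖ ^ 2 ∂ν := by
  have h1 : ‖∫ x, A x (b x) ∂ν‖ ≤ ∫ x, ‖A x‖ * ‖b x‖ ∂ν :=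
    norm_integral_le_of_norm_le (hA.norm.integrable_mul hb.norm)
      (Filter.Eventually.of_forall fun x => (A x).le_opNorm _)
  exact (pow_le_pow_left₀ (norm_nonneg _) h1 2).trans (integral_mul_sq_le hA.norm hb.norm
    (fun _ => norm_nonneg _) fun _ => norm_nonneg _)

/-- No factor appears because `(-1, 0)` has measure one. -/
lemma L2.norm_le_of_ae_bound {g : L2 𝕜 n} {C : ℝ} (hC : 0 ≤ C)
    (h : ∀ᵐ x ∂intervalMeasure, ‖g x‖ ≤ C) : ‖g‖ ≤ C := by
  have := Lp.norm_le_of_ae_bound hC h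
  have h1 : measureUnivNNReal intervalMeasure = 1 := by
    simp [measureUnivNNReal]
  simpa [h1] using this

lemma L2.norm_sq_eq (g : L2 𝕜 n) : ‖g‖ ^ 2 = ∫ x, ‖g x‖ ^ 2 ∂intervalMeasure := by
  have h := MeasureTheory.L2.inner_def (𝕜 := 𝕜) g g
  simp only [inner_self_eq_norm_sq_to_K] at h
  have h2 : ∫ x, ((‖g x‖ : ℝ) : 𝕜) ^ 2 ∂intervalMeasure =
      ((∫ x, ‖g x‖ ^ 2 ∂intervalMeasure : ℝ) : 𝕜) := by
    rw [← integral_ofReal]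
    simp
  rw [h2] at h
  exact_mod_cast h

lemma measurePreserving_reflect_Ioo (θ : ℝ) :
    MeasurePreserving (fun τ : ℝ => θ - τ) (volume.restrict (Ioo θ 0))
      (volume.restrict (Ioo θ 0)) := by
  have h0 : MeasurePreserving (fun τ : ℝ => θ - τ) volume volume :=
    Measure.measurePreserving_sub_left volume θ
  have h := h0.restrict_preimage (measurableSet_Ioo (a := θ) (b := 0))
  have hs : (fun τ : ℝ => θ - τ) ⁻¹' Ioo θ 0 = Ioo θ 0 := by
    ext x
    simp only [mem_preimage, mem_Ioo]
    constructor <;> rintro ⟨h1, h2⟩ <;> constructor <;> linarith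
  rw [hs] at h
  exact h

/-- Cauchy–Schwarz on `(θ, 0)`, followed by the substitution `s = θ - τ`. Keeping the last integral
over `(θ, 0)`, rather than over the whole interval, is what makes Gronwall's inequality applicable
later. -/
lemma norm_conv_sq_le {A : ℝ → (Vec 𝕜 n →L[𝕜] Vec 𝕜 n)} {b : ℝ → Vec 𝕜 n}
    (hA : MemLp A 2 intervalMeasure) (hb : MemLp b 2 intervalMeasure) {θ : ℝ}
    (hθ : θ ∈ Icc (-1 : ℝ) 0) :
    ‖∫ τ in (0 : ℝ)..θ, A τ (b (τ - θ - 1))‖ ^ 2 ≤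
      (∫ τ, ‖A τ‖ ^ 2 ∂intervalMeasure) * ∫ s in Ioo θ 0, ‖b (-1 - s)‖ ^ 2 := by
  have hsub : volume.restrict (Ioo θ 0) ≤ intervalMeasure :=
    Measure.restrict_mono_set _ (Ioo_subset_Ioo_left hθ.1)
  rw [intervalIntegral.integral_symm, norm_neg, intervalIntegral.integral_of_le hθ.2,
    ← Measure.restrict_congr_set Ioo_ae_eq_Ioc]
  refine (norm_integral_apply_sq_le (hA.mono_measure hsub) (memLp_shift hb hθ)).trans ?_
  have h3 : ∫ τ in Ioo θ 0, ‖b (τ - θ - 1)‖ ^ 2 = ∫ s in Ioo θ 0, ‖b (-1 - s)‖ ^ 2 := by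
    rw [← (measurePreserving_reflect_Ioo θ).integral_comp
      (Homeomorph.subLeft θ).measurableEmbedding]
    refine integral_congr_ae (Filter.Eventually.of_forall fun τ => ?_)
    simp only
    congr 3
    ring
  rw [h3]
  refine mul_le_mul_of_nonneg_right (integral_mono_measure hsub
    (Filter.Eventually.of_forall fun τ => by positivity)
    (hA.integrable_norm_pow (by norm_num))) (integral_nonneg fun _ => by positivity)

/-- `θ ↦ b(-1 - θ)` as an element of `L₂`. -/
noncomputable def reflL2 (b : L2 𝕜 n) : L2 𝕜 n := (memLp_reflect (Lp.memLp b)).toLp _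

lemma coeFn_reflL2 (b : L2 𝕜 n) : reflL2 b =ᵐ[intervalMeasure] fun θ => b (-1 - θ) :=
  (memLp_reflect (Lp.memLp b)).coeFn_toLp

lemma norm_reflL2 (b : L2 𝕜 n) : ‖reflL2 b‖ = ‖b‖ := by
  rw [reflL2, Lp.norm_toLp, Lp.norm_def]
  congr 1
  exact eLpNorm_comp_measurePreserving (Lp.aestronglyMeasurable b) measurePreserving_reflect

/-- `θ ↦ ∫₀^θ A(τ) b(τ - θ - 1) dτ` as an element of `L₂`. -/
noncomputable def convL2 (A : ℝ → (Vec 𝕜 n →L[𝕜] Vec 𝕜 n)) (hA : MemLp A 2 intervalMeasure) (b : L2 𝕜 n) :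
    L2 𝕜 n := (memLp_conv hA (Lp.memLp b)).toLp _

lemma coeFn_convL2 {A : ℝ → (Vec 𝕜 n →L[𝕜] Vec 𝕜 n)} (hA : MemLp A 2 intervalMeasure)
    (b : L2 𝕜 n) :
    convL2 A hA b =ᵐ[intervalMeasure] fun θ => ∫ τ in (0 : ℝ)..θ, A τ (b (τ - θ - 1)) :=
  (memLp_conv hA (Lp.memLp b)).coeFn_toLp

lemma integral_reflect_sq (b : L2 𝕜 n) :
    ∫ s, ‖b (-1 - s)‖ ^ 2 ∂intervalMeasure = ‖b‖ ^ 2 := by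
  rw [← norm_reflL2, L2.norm_sq_eq]
  refine integral_congr_ae ?_
  filter_upwards [coeFn_reflL2 b] with s hs
  rw [hs]

lemma norm_convL2_le {A : ℝ → (Vec 𝕜 n →L[𝕜] Vec 𝕜 n)} (hA : MemLp A 2 intervalMeasure)
    (b : L2 𝕜 n) : ‖convL2 A hA b‖ ≤ √(∫ τ, ‖A τ‖ ^ 2 ∂intervalMeasure) * ‖b‖ := by
  refine L2.norm_le_of_ae_bound (by positivity) ?_
  filter_upwards [coeFn_convL2 hA b, ae_restrict_mem measurableSet_Ioo]
    with θ h1 hθ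
  rw [h1]
  refine le_of_sq_le_sq ?_ (by positivity)
  refine (norm_conv_sq_le hA (Lp.memLp b) (Ioo_subset_Icc_self hθ)).trans ?_
  rw [mul_pow, Real.sq_sqrt (integral_nonneg fun _ => by positivity), ← integral_reflect_sq]
  refine mul_le_mul_of_nonneg_left (integral_mono_measure
    (Measure.restrict_mono_set _ (Ioo_subset_Ioo_left hθ.1.le))
    (Filter.Eventually.of_forall fun τ => by positivity)
    ((memLp_reflect (Lp.memLp b)).integrable_norm_pow (by norm_num)))
    (integral_nonneg fun _ => by positivity)

lemma norm_integral_act_le {A : ℝ → (Vec 𝕜 n →L[𝕜] Vec 𝕜 n)} (hA : MemLp A 2 intervalMeasure)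
    (b : L2 𝕜 n) :
    ‖∫ τ, A τ (b τ) ∂intervalMeasure‖ ≤ √(∫ τ, ‖A τ‖ ^ 2 ∂intervalMeasure) * ‖b‖ := by
  refine le_of_sq_le_sq ?_ (by positivity)
  rw [mul_pow, Real.sq_sqrt (integral_nonneg fun _ => by positivity), L2.norm_sq_eq]
  exact norm_integral_apply_sq_le hA (Lp.memLp b)

lemma integral_norm_le (g : L2 𝕜 n) : ∫ x, ‖g x‖ ∂intervalMeasure ≤ ‖g‖ := by
  refine le_of_sq_le_sq ?_ (norm_nonneg _)
  have h := integral_mul_sq_le (Lp.memLp g).norm (memLp_const (1 : ℝ))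
    (fun _ => norm_nonneg _) fun _ => zero_le_one
  rw [← L2.norm_sq_eq] at h
  simpa using h

lemma norm_primitive_le (c : Vec 𝕜 n) (g : L2 𝕜 n) {θ : ℝ} (hθ : θ ∈ Icc (-1 : ℝ) 0) :
    ‖primitive c g θ‖ ≤ ‖c‖ + ‖g‖ := by
  refine (norm_add_le _ _).trans (add_le_add le_rfl ?_)
  rw [intervalIntegral.integral_symm, norm_neg, intervalIntegral.integral_of_le hθ.2,
    ← Measure.restrict_congr_set Ioo_ae_eq_Ioc]
  refine (norm_integral_le_integral_norm _).trans (le_trans ?_ (integral_norm_le g))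
  exact integral_mono_measure (Measure.restrict_mono_set _ (Ioo_subset_Ioo_left hθ.1))
      (Filter.Eventually.of_forall fun τ => by positivity)
      ((Lp.memLp g).integrable (by norm_num)).norm

lemma coeFn_primitiveL2 (p : Vec 𝕜 n × L2 𝕜 n) :
    primitiveL2 p =ᵐ[intervalMeasure] primitive p.1 p.2 :=
  (memLp_primitive p.1 p.2).coeFn_toLp

lemma norm_primitiveL2_le (c : Vec 𝕜 n) (g : L2 𝕜 n) :
    ‖primitiveL2 (c, g)‖ ≤ ‖c‖ + ‖g‖ := by
  refine L2.norm_le_of_ae_bound (by positivity) ?_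
  filter_upwards [coeFn_primitiveL2 (c, g), ae_restrict_mem measurableSet_Ioo] with θ h1 hθ
  rw [h1]
  exact norm_primitive_le c g (Ioo_subset_Icc_self hθ)

/-- A linear map on a finite-dimensional space is bounded. -/
lemma exists_norm_mulL2_le {A : ℝ → Matrix (Fin n) (Fin n) 𝕜}
    (hA : ∀ i j, MemLp (fun θ => A θ i j) 2 intervalMeasure) :
    ∃ C, 0 ≤ C ∧ ∀ w, ‖mulL2 A hA w‖ ≤ C * ‖w‖ :=
  ⟨‖(mulL2 A hA).toContinuousLinearMap‖, norm_nonneg _,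
    fun w => (mulL2 A hA).toContinuousLinearMap.le_opNorm w⟩

end Estimates

/-! ### Gronwall's inequality, run backwards from `0` to `-1`. -/

section Gronwall

/-- An integral form of Gronwall's inequality, for integrable functions on `(-1, 0)`. -/
lemma integral_le_of_le_add_integral {φ μ : ℝ → ℝ} (hφ : Integrable φ intervalMeasure)
    (hμ : Integrable μ intervalMeasure) (hφ0 : ∀ θ, 0 ≤ φ θ) (hμ0 : ∀ θ, 0 ≤ μ θ) {K : ℝ}
    (hK : 0 ≤ K) (h : ∀ᵐ θ ∂intervalMeasure, φ θ ≤ μ θ + K * ∫ s in Ioo θ 0, φ s) :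
    ∫ s, φ s ∂intervalMeasure ≤
      (1 + K * gronwallBound 0 K 1 1) * ∫ s, μ s ∂intervalMeasure := by
  -- Extension by zero makes the tail integral `β` continuous on all of `ℝ`.
  set φ' : ℝ → ℝ := (Ioo (-1 : ℝ) 0).indicator φ with hφ'
  have hφi : Integrable φ' := IntegrableOn.integrable_indicator hφ measurableSet_Ioo
  set M := ∫ s, μ s ∂intervalMeasure with hM
  set β : ℝ → ℝ := fun θ => ∫ s in θ..0, φ' s with hβ
  have hβc : Continuous β := by
    simp only [hβ, intervalIntegral.integral_symm 0]
    exact (intervalIntegral.continuous_primitive (fun _ _ => hφi.intervalIntegrable) (0 : ℝ)).neg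
  have hβeq : ∀ θ ∈ Icc (-1 : ℝ) 0, β θ = ∫ s in Ioo θ 0, φ s := by
    intro θ hθ
    rw [hβ]
    simp only
    rw [intervalIntegral.integral_of_le hθ.2, integral_Ioc_eq_integral_Ioo]
    refine setIntegral_congr_fun measurableSet_Ioo fun s hs => ?_
    rw [hφ', indicator_of_mem (Ioo_subset_Ioo_left hθ.1 hs)]
  have hβ0 : ∀ θ ∈ Icc (-1 : ℝ) 0, 0 ≤ β θ := fun θ hθ => by
    rw [hβeq θ hθ]; exact integral_nonneg fun s => hφ0 s
  -- Integrating the hypothesis over `(θ, 0)` replaces the merely integrable `φ` by the continuous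
  -- `β`, whose primitive is differentiable everywhere.
  have hint : ∀ θ ∈ Icc (-1 : ℝ) 0, β θ ≤ M + K * ∫ s in θ..0, β s := by
    intro θ hθ
    have hsub : volume.restrict (Ioo θ 0) ≤ intervalMeasure :=
      Measure.restrict_mono_set _ (Ioo_subset_Ioo_left hθ.1)
    have hβi : Integrable β (volume.restrict (Ioo θ 0)) :=
      (hβc.integrableOn_Icc (a := θ) (b := 0)).mono_set Ioo_subset_Icc_self
    rw [hβeq θ hθ]
    calc ∫ s in Ioo θ 0, φ s ≤ ∫ s in Ioo θ 0, (μ s + K * β s) := by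
          refine integral_mono_ae (hφ.mono_measure hsub)
            ((hμ.mono_measure hsub).add (hβi.const_mul K)) ?_
          filter_upwards [ae_mono hsub h, ae_restrict_mem measurableSet_Ioo] with s hs hs'
          rw [hβeq s ⟨hθ.1.trans hs'.1.le, hs'.2.le⟩]
          exact hs
      _ = (∫ s in Ioo θ 0, μ s) + K * ∫ s in Ioo θ 0, β s := by
          rw [integral_add (hμ.mono_measure hsub) (hβi.const_mul K), integral_const_mul]
      _ ≤ M + K * ∫ s in θ..0, β s := by
          rw [intervalIntegral.integral_of_le hθ.2, integral_Ioc_eq_integral_Ioo]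
          exact add_le_add (integral_mono_measure hsub
            (Filter.Eventually.of_forall fun s => hμ0 s) hμ) le_rfl
  -- The differential Gronwall inequality in the reversed time `t = -θ`, for the primitive of
  -- `β(-t)`, which vanishes at `t = 0`.
  have hgr := norm_le_gronwallBound_of_norm_deriv_right_le (δ := 0) (K := K) (ε := M)
    (f := fun t => ∫ s in (0 : ℝ)..t, β (-s)) (f' := fun t => β (-t)) (a := 0) (b := 1)
    (by
      refine Continuous.continuousOn ?_
      exact intervalIntegral.continuous_primitive
        (fun a b => (hβc.comp continuous_neg).intervalIntegrable a b) 0)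
    (fun x _ => ((hβc.comp continuous_neg).integral_hasStrictDerivAt 0 x).hasDerivAt.hasDerivWithinAt)
    (by simp)
    (by
      intro t ht
      have ht' : -t ∈ Icc (-1 : ℝ) 0 := ⟨by linarith [ht.2], by linarith [ht.1]⟩
      have h1 : ∫ s in (0 : ℝ)..t, β (-s) = ∫ s in -t..0, β s := by
        rw [intervalIntegral.integral_comp_neg]; simp
      rw [Real.norm_of_nonneg (hβ0 _ ht'), h1]
      have := hint _ ht'
      have h2 := mul_le_mul_of_nonneg_left (le_abs_self (∫ s in -t..0, β s)) hK
      rw [Real.norm_eq_abs]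
      linarith) 1 (by simp)
  have h1 := hint (-1) (by simp)
  have h2 : ∫ s in (0 : ℝ)..1, β (-s) = ∫ s in (-1)..0, β s := by
    rw [intervalIntegral.integral_comp_neg]; simp
  rw [h2] at hgr
  rw [hβeq (-1) (by simp)] at h1
  -- With zero initial value the bound is linear in the inhomogeneity `M`, both for `K = 0` and for
  -- `K ≠ 0`.
  have h3 : gronwallBound 0 K M (1 - 0) = gronwallBound 0 K 1 1 * M := by
    unfold gronwallBound
    split_ifs <;> (simp; try ring)
  rw [h3] at hgr
  have h4 := mul_le_mul_of_nonneg_left ((le_abs_self _).trans hgr) hK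
  linarith

end Gronwall

/-! ### A lower bound for the Volterra operator. -/

section Volterra

variable {𝕜 : Type*} [RCLike 𝕜] {n : ℕ}

/-- The Volterra operator `b ↦ b(-1 - ·) + A * b - ∫₀ B * b` is bounded below. -/
lemma exists_norm_le_volterra {A B : ℝ → (Vec 𝕜 n →L[𝕜] Vec 𝕜 n)}
    (hA : MemLp A 2 intervalMeasure) (hB : MemLp B 2 intervalMeasure) :
    ∃ C, 0 ≤ C ∧ ∀ b : L2 𝕜 n,
      ‖b‖ ≤ C * ‖reflL2 b + convL2 A hA b - primitiveL2 (0, convL2 B hB b)‖ := by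
  set a := ∫ τ, ‖A τ‖ ^ 2 ∂intervalMeasure with ha
  set c := ∫ τ, ‖B τ‖ ^ 2 ∂intervalMeasure with hc
  have ha0 : 0 ≤ a := integral_nonneg fun _ => by positivity
  have hc0 : 0 ≤ c := integral_nonneg fun _ => by positivity
  -- The factor `3` comes from `(x + y + z)² ≤ 3 (x² + y² + z²)`, applied to `b(-1 - θ) = m - q +
  -- p`.
  set K := 3 * (a + c) with hK
  have hK0 : 0 ≤ K := by positivity
  refine ⟨√((1 + K * gronwallBound 0 K 1 1) * 3), by positivity, fun b => ?_⟩
  set m := reflL2 b + convL2 A hA b - primitiveL2 (0, convL2 B hB b) with hm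
  set φ : ℝ → ℝ := fun θ => ‖b (-1 - θ)‖ ^ 2 with hφ
  have hφi : Integrable φ intervalMeasure :=
    (memLp_reflect (Lp.memLp b)).integrable_norm_pow (by norm_num)
  have hmi : Integrable (fun θ => 3 * ‖m θ‖ ^ 2) intervalMeasure :=
    ((Lp.memLp m).integrable_norm_pow (by norm_num)).const_mul 3
  have hprim : ∀ θ ∈ Icc (-1 : ℝ) 0,
      ‖primitive 0 (convL2 B hB b) θ‖ ^ 2 ≤ c * ∫ s in Ioo θ 0, φ s := by
    intro θ hθ
    have hI0 : 0 ≤ ∫ s in Ioo θ 0, φ s := integral_nonneg fun _ => by positivity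
    rw [← Real.sq_sqrt (mul_nonneg hc0 hI0)]
    refine pow_le_pow_left₀ (norm_nonneg _) ?_ 2
    rw [primitive, zero_add, intervalIntegral_congr_L2 (coeFn_convL2 hB b) hθ]
    -- The integrand at `x ∈ (θ, 0]` is bounded through an integral over `(x, 0)`, hence through the
    -- one over `(θ, 0)`; the length of the interval is at most one.
    refine (intervalIntegral.norm_integral_le_of_norm_le_const
      (C := √(c * ∫ s in Ioo θ 0, φ s)) fun x hx => ?_).trans ?_
    · rw [uIoc_of_ge hθ.2] at hx
      refine Real.le_sqrt_of_sq_le ?_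
      refine (norm_conv_sq_le hB (Lp.memLp b) ⟨hθ.1.trans hx.1.le, hx.2⟩).trans ?_
      refine mul_le_mul_of_nonneg_left (integral_mono_measure
        (Measure.restrict_mono_set _ (Ioo_subset_Ioo_left hx.1.le))
        (Filter.Eventually.of_forall fun τ => by positivity)
        (hφi.mono_measure (Measure.restrict_mono_set _ (Ioo_subset_Ioo_left hθ.1)))) hc0
    · refine mul_le_of_le_one_right (Real.sqrt_nonneg _) ?_
      rw [sub_zero, abs_of_nonpos hθ.2]
      linarith [hθ.1]
  have key : ∀ᵐ θ ∂intervalMeasure, φ θ ≤ 3 * ‖m θ‖ ^ 2 + K * ∫ s in Ioo θ 0, φ s := by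
    filter_upwards [ae_restrict_mem measurableSet_Ioo,
      Lp.coeFn_sub (reflL2 b + convL2 A hA b) (primitiveL2 (0, convL2 B hB b)),
      Lp.coeFn_add (reflL2 b) (convL2 A hA b), coeFn_reflL2 b,
      coeFn_convL2 hA b, coeFn_primitiveL2 (0, convL2 B hB b)]
      with θ hθ h1 h2 h3 h4 h5
    have hθ' := Ioo_subset_Icc_self hθ
    rw [Pi.sub_apply, h2, Pi.add_apply, h5, h3, h4] at h1
    have h6 := norm_conv_sq_le hA (Lp.memLp b) hθ'
    have h7 := hprim θ hθ'
    rw [← hm] at h1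
    set p := primitive 0 (convL2 B hB b) θ
    set q := ∫ τ in (0 : ℝ)..θ, A τ (b (τ - θ - 1))
    have h8 : b (-1 - θ) = m θ - q + p := by rw [h1]; abel
    have h9 : ‖b (-1 - θ)‖ ≤ ‖m θ‖ + ‖q‖ + ‖p‖ := by
      rw [h8]; exact (norm_add_le _ _).trans (add_le_add (norm_sub_le _ _) le_rfl)
    have h10 : ‖b (-1 - θ)‖ ^ 2 ≤ (‖m θ‖ + ‖q‖ + ‖p‖) ^ 2 :=
      pow_le_pow_left₀ (norm_nonneg _) h9 2
    rw [hK]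
    simp only [hφ] at h7 ⊢
    nlinarith [sq_nonneg (‖m θ‖ - ‖q‖), sq_nonneg (‖m θ‖ - ‖p‖), sq_nonneg (‖q‖ - ‖p‖)]
  have := integral_le_of_le_add_integral hφi hmi (fun _ => by positivity)
    (fun _ => by positivity) hK0 key
  rw [integral_reflect_sq, integral_const_mul, ← L2.norm_sq_eq, ← mul_assoc] at this
  rw [← Real.sqrt_sq (norm_nonneg b), ← Real.sqrt_sq (norm_nonneg m), ← Real.sqrt_mul' _ (sq_nonneg _)]
  exact Real.sqrt_le_sqrt this

end Volterra

/-! ### Fubini's theorem and the derivative of a convolution. -/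

section Fubini

variable {𝕜 : Type*} [RCLike 𝕜] {n : ℕ}

lemma integrable_indicator_of_memLp {E : Type*} [NormedAddCommGroup E] {f : ℝ → E}
    (hf : MemLp f 2 intervalMeasure) : Integrable ((Ioo (-1 : ℝ) 0).indicator f) volume := by
  have h : IntegrableOn f (Ioo (-1) 0) := hf.integrable one_le_two
  exact h.integrable_indicator measurableSet_Ioo

/-- After reflecting `b` and extending by zero, this is the integrand of an ordinary convolution of
two integrable functions on the line. -/
lemma integrable_conv_integrand {A : ℝ → (Vec 𝕜 n →L[𝕜] Vec 𝕜 n)} {b : ℝ → Vec 𝕜 n}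
    (hA : MemLp A 2 intervalMeasure) (hb : MemLp b 2 intervalMeasure) :
    Integrable (fun p : ℝ × ℝ => (Ioo (-1 : ℝ) 0).indicator A p.2
      ((Ioo (-1 : ℝ) 0).indicator (fun x => b (-1 - x)) (p.1 - p.2))) (volume.prod volume) :=
  (integrable_indicator_of_memLp hA).convolution_integrand
    (ContinuousLinearMap.id 𝕜 (Vec 𝕜 n →L[𝕜] Vec 𝕜 n))
    (integrable_indicator_of_memLp (memLp_reflect hb))

/-- Fubini on the triangle `θ < s < τ < 0`. Both sides become integrals over the square `(θ, 0)²`,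
since the zero extension of the reflected `b` kills the part `s ≥ τ`. -/
lemma integral_conv {A : ℝ → (Vec 𝕜 n →L[𝕜] Vec 𝕜 n)} {b : ℝ → Vec 𝕜 n}
    (hA : MemLp A 2 intervalMeasure) (hb : MemLp b 2 intervalMeasure) {θ : ℝ}
    (hθ : θ ∈ Icc (-1 : ℝ) 0) :
    ∫ s in (0 : ℝ)..θ, ∫ τ in (0 : ℝ)..s, A τ (b (τ - s - 1)) =
      ∫ τ in (0 : ℝ)..θ, A τ (∫ s in τ..θ, b (τ - s - 1)) := by
  set f := (Ioo (-1 : ℝ) 0).indicator A with hf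
  set g := (Ioo (-1 : ℝ) 0).indicator (fun x => b (-1 - x)) with hg
  have hH : Integrable (fun p : ℝ × ℝ => f p.2 (g (p.1 - p.2)))
      ((volume.restrict (Ioo θ 0)).prod (volume.restrict (Ioo θ 0))) := by
    rw [Measure.prod_restrict]
    exact (integrable_conv_integrand hA hb).integrableOn
  have hsw := integral_integral_swap (f := fun s τ => f τ (g (s - τ))) hH
  have hval : ∀ s ∈ Ioo θ 0, ∀ τ ∈ Ioo θ 0, f τ (g (s - τ)) =
      if s < τ then A τ (b (τ - s - 1)) else 0 := by
    intro s hs τ hτ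
    rw [hf, hg, indicator_of_mem (Ioo_subset_Ioo_left hθ.1 hτ)]
    split_ifs with h
    · have hst : s - τ ∈ Ioo (-1 : ℝ) 0 := ⟨by linarith [hs.1, hτ.2, hθ.1], by linarith⟩
      rw [indicator_of_mem hst]
      congr 2
      ring
    · rw [indicator_of_notMem (fun h' => h (by linarith [h'.2])), map_zero]
  have hL : ∫ s in (0 : ℝ)..θ, ∫ τ in (0 : ℝ)..s, A τ (b (τ - s - 1)) =
      ∫ s in Ioo θ 0, ∫ τ in Ioo θ 0, f τ (g (s - τ)) := by
    rw [intervalIntegral.integral_symm, intervalIntegral.integral_of_le hθ.2,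
      integral_Ioc_eq_integral_Ioo, ← integral_neg]
    refine setIntegral_congr_fun measurableSet_Ioo fun s hs => ?_
    rw [intervalIntegral.integral_symm, neg_neg, intervalIntegral.integral_of_le hs.2.le,
      integral_Ioc_eq_integral_Ioo]
    rw [setIntegral_congr_fun measurableSet_Ioo (hval s hs)]
    have : (fun τ => if s < τ then A τ (b (τ - s - 1)) else 0) =
      (Ioi s).indicator fun τ => A τ (b (τ - s - 1)) := by
      funext τ; simp [indicator]
    rw [this, setIntegral_indicator measurableSet_Ioi]
    congr 2
    ext x
    simp only [mem_inter_iff, mem_Ioi, mem_Ioo]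
    constructor
    · rintro ⟨h1, h2⟩; exact ⟨⟨hs.1.trans h1, h2⟩, h1⟩
    · rintro ⟨⟨_, h1⟩, h2⟩; exact ⟨h2, h1⟩
  have hR : ∫ τ in (0 : ℝ)..θ, A τ (∫ s in τ..θ, b (τ - s - 1)) =
      ∫ τ in Ioo θ 0, ∫ s in Ioo θ 0, f τ (g (s - τ)) := by
    rw [intervalIntegral.integral_symm, intervalIntegral.integral_of_le hθ.2,
      integral_Ioc_eq_integral_Ioo, ← integral_neg]
    refine setIntegral_congr_fun measurableSet_Ioo fun τ hτ => ?_
    -- Integrability is needed to move the operator `A τ` inside the integral over `s`.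
    have hbi : IntegrableOn (fun s => b (τ - s - 1)) (Ioo θ τ) := by
      have h1 : IntervalIntegrable b volume (-1) (τ - 1 - θ) := by
        rw [intervalIntegrable_iff, uIoc_of_le (by linarith [hτ.1]),
          integrableOn_Ioc_iff_integrableOn_Ioo]
        exact IntegrableOn.mono_set (hb.integrable (by norm_num))
          (Ioo_subset_Ioo_right (by linarith [hτ.2, hθ.1]))
      have h2 := (h1.comp_sub_left (τ - 1)).symm
      rw [intervalIntegrable_iff, uIoc_of_le (by linarith [hτ.1]),
          integrableOn_Ioc_iff_integrableOn_Ioo] at h2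
      rw [show τ - 1 - (τ - 1 - θ) = θ by ring, show τ - 1 - -1 = τ by ring] at h2
      simpa only [sub_right_comm] using h2
    rw [intervalIntegral.integral_symm, map_neg, neg_neg, intervalIntegral.integral_of_le hτ.1.le,
      integral_Ioc_eq_integral_Ioo, ← ContinuousLinearMap.integral_comp_comm _ hbi]
    rw [setIntegral_congr_fun measurableSet_Ioo (fun s hs => hval s hs τ hτ)]
    have : (fun s => if s < τ then A τ (b (τ - s - 1)) else 0) =
      (Iio τ).indicator fun s => A τ (b (τ - s - 1)) := by
      funext τ; simp [indicator]
    rw [this, setIntegral_indicator measurableSet_Iio]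
    congr 2
    ext x
    simp only [mem_inter_iff, mem_Iio, mem_Ioo]
    constructor
    · rintro ⟨h1, h2⟩; exact ⟨⟨h1, h2.trans hτ.2⟩, h2⟩
    · rintro ⟨⟨h1, _⟩, h2⟩; exact ⟨h1, h2⟩
  rw [hL, hR, hsw]

/-- The derivative of `θ ↦ Z(-1 - θ) + ∫₀^θ A(τ) Z(τ - θ - 1) dτ`, `Z(θ) = c + ∫₀^θ g`, is
`-g(-1 - θ) - ∫₀^θ A(τ) g(τ - θ - 1) dτ + A(θ) Z(-1)`. -/
lemma primitive_reflect_add_conv {A : ℝ → Matrix (Fin n) (Fin n) 𝕜}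
    (hA : ∀ i j, MemLp (fun θ => A θ i j) 2 intervalMeasure) (c : Vec 𝕜 n) (g : L2 𝕜 n) {θ : ℝ}
    (hθ : θ ∈ Icc (-1 : ℝ) 0) :
    primitive (primitive c g (-1)) (-(reflL2 g + convL2 (fun θ => act (A θ)) (memLp_act hA) g)
      + mulL2 A hA (primitive c g (-1))) θ =
    primitive c g (-1 - θ) + ∫ τ in (0 : ℝ)..θ, act (A τ) (primitive c g (τ - θ - 1)) := by
  set e := primitive c g (-1) with he
  set R := reflL2 g
  set V := convL2 (fun θ => act (A θ)) (memLp_act hA) g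
  set W := mulL2 A hA e
  have hgi : ∀ x ∈ Icc (-1 : ℝ) 0, ∀ y ∈ Icc (-1 : ℝ) 0, IntervalIntegrable g volume x y :=
    fun x hx y hy => (L2.intervalIntegrable g hx).symm.trans (L2.intervalIntegrable g hy)
  have hm1 : (-1 : ℝ) ∈ Icc (-1 : ℝ) 0 := by simp
  -- The primitive is rebased at `-1`, the point to which `-1 - θ` and `τ - θ - 1` reduce at the
  -- start of integration.
  have hprim : ∀ x ∈ Icc (-1 : ℝ) 0, primitive c g x = e + ∫ s in (-1 : ℝ)..x, g s := by
    intro x hx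
    rw [he, primitive, primitive, add_assoc, intervalIntegral.integral_add_adjacent_intervals
      (L2.intervalIntegrable g hm1) (hgi _ hm1 _ hx)]
  have hneg : (-(R + V) + W : L2 𝕜 n) = W - R - V := by abel
  have hsplit : ∫ s in (0 : ℝ)..θ, (-(R + V) + W : L2 𝕜 n) s =
      (∫ s in (0 : ℝ)..θ, W s) - (∫ s in (0 : ℝ)..θ, R s) - ∫ s in (0 : ℝ)..θ, V s := by
    rw [hneg, intervalIntegral_congr_L2 ((Lp.coeFn_sub (W - R) V).trans
      ((Lp.coeFn_sub W R).sub (Filter.EventuallyEq.refl _ _))) hθ]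
    simp only [Pi.sub_apply]
    rw [intervalIntegral.integral_sub ((L2.intervalIntegrable W hθ).sub
      (L2.intervalIntegrable R hθ)) (L2.intervalIntegrable V hθ), intervalIntegral.integral_sub
      (L2.intervalIntegrable W hθ) (L2.intervalIntegrable R hθ)]
  have hW : ∫ s in (0 : ℝ)..θ, W s = ∫ s in (0 : ℝ)..θ, act (A s) e :=
    intervalIntegral_congr_L2 (memLp_act_apply hA e).coeFn_toLp hθ
  have hR : ∫ s in (0 : ℝ)..θ, R s = -∫ s in (-1 : ℝ)..(-1 - θ), g s := by
    rw [intervalIntegral_congr_L2 (coeFn_reflL2 g) hθ,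
      intervalIntegral.integral_comp_sub_left (fun x => g x), sub_zero,
      intervalIntegral.integral_symm]
  have hV : ∫ s in (0 : ℝ)..θ, V s =
      ∫ τ in (0 : ℝ)..θ, act (A τ) (∫ s in τ..θ, g (τ - s - 1)) := by
    rw [intervalIntegral_congr_L2 (coeFn_convL2 (memLp_act hA) g) hθ,
      integral_conv (memLp_act hA) (Lp.memLp g) hθ]
  have hWi : IntervalIntegrable (fun s => act (A s) e) volume 0 θ := by
    have := integrable_conv (memLp_act hA) (memLp_const e) hθ
    exact this
  have hQi : IntervalIntegrable (fun τ => act (A τ) (primitive c g (τ - θ - 1))) volume 0 θ :=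
    integrable_conv (memLp_act hA) (memLp_primitive c g) hθ
  -- The substitution `s ↦ τ - 1 - s` turns the inner integral into `-∫ g` over `(-1, τ - θ - 1)`,
  -- that is `Z(-1) - Z(τ - θ - 1)` for the primitive `Z` of `g`.
  have hQ : ∀ τ ∈ uIoc 0 θ, act (A τ) (∫ s in τ..θ, g (τ - s - 1)) =
      act (A τ) e - act (A τ) (primitive c g (τ - θ - 1)) := by
    intro τ hτ
    rw [uIoc_of_ge hθ.2] at hτ
    rw [← map_sub, hprim (τ - θ - 1) ⟨by linarith [hτ.1], by linarith [hτ.2, hθ.1]⟩]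
    congr 1
    have := intervalIntegral.integral_comp_sub_left (fun x => g x) (τ - 1) (a := τ) (b := θ)
    have h2 : (fun s => g (τ - s - 1)) = fun s => g (τ - 1 - s) := by
      funext s; congr 1; ring
    rw [h2, this, intervalIntegral.integral_symm]
    rw [show τ - 1 - τ = -1 by ring, show τ - 1 - θ = τ - θ - 1 by ring]
    abel
  have hV2 : ∫ τ in (0 : ℝ)..θ, act (A τ) (∫ s in τ..θ, g (τ - s - 1)) =
      (∫ s in (0 : ℝ)..θ, act (A s) e) -
        ∫ τ in (0 : ℝ)..θ, act (A τ) (primitive c g (τ - θ - 1)) := by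
    rw [← intervalIntegral.integral_sub hWi hQi]
    refine intervalIntegral.integral_congr_ae (Filter.Eventually.of_forall hQ)
  rw [primitive, hsplit, hW, hR, hV, hV2, hprim (-1 - θ) ⟨by linarith [hθ.2], by linarith [hθ.1]⟩]
  abel

end Fubini

/-! ### The defining property of the resolvent. -/

section Resolvent

variable {𝕜 : Type*} [RCLike 𝕜] {X : Type*} [NormedAddCommGroup X] [NormedSpace 𝕜 X]

lemma isResolventAt_resolventOp {T : X →ₗ.[𝕜] X} {lam : 𝕜} (h : lam ∉ opSpectrum T) :
    IsResolventAt T lam (resolventOp T lam) := by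
  have h' : ∃ R : X →L[𝕜] X, IsResolventAt T lam R := by
    exact not_not.1 h
  rw [resolventOp, dif_pos h']
  exact h'.choose_spec

end Resolvent

/-! ### Component norms of `M₂`, traces of `H¹` functions, and constants. -/

section Data

variable {𝕜 : Type*} [RCLike 𝕜] {n : ℕ}

lemma M2.norm_le (x : M2 𝕜 n) : ‖x‖ ≤ ‖x.fst‖ + ‖x.snd‖ := by
  refine le_of_sq_le_sq ?_ (by positivity)
  rw [WithLp.prod_norm_sq_eq_of_L2]
  nlinarith [norm_nonneg x.fst, norm_nonneg x.snd]

lemma M2.norm_fst_le (x : M2 𝕜 n) : ‖x.fst‖ ≤ ‖x‖ := WithLp.norm_fst_le _ x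

lemma M2.norm_snd_le (x : M2 𝕜 n) : ‖x.snd‖ ≤ ‖x‖ := WithLp.norm_snd_le _ x

lemma primitiveL2_data (z : H1 𝕜 n) : primitiveL2 (H1.data z) = (z : L2 𝕜 n) :=
  congrArg Subtype.val ((LinearEquiv.ofInjective primitiveL2 primitiveL2_injective).apply_symm_apply z)

lemma H1.data_eq {z : H1 𝕜 n} {p : Vec 𝕜 n × L2 𝕜 n} (h : (z : L2 𝕜 n) = primitiveL2 p) :
    H1.data z = p :=
  primitiveL2_injective ((primitiveL2_data z).trans h)

lemma H1.evalZero_eq (z : H1 𝕜 n) : H1.evalZero z = (H1.data z).1 := by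
  change primitive (H1.data z).1 (H1.data z).2 0 = _
  simp [primitive]

/-- The constant function `k` as an element of `L₂`. -/
noncomputable def constL2 (k : Vec 𝕜 n) : L2 𝕜 n := (memLp_const k).toLp _

lemma norm_constL2_le (k : Vec 𝕜 n) : ‖constL2 k‖ ≤ ‖k‖ := by
  refine L2.norm_le_of_ae_bound (norm_nonneg _) ?_
  filter_upwards [(memLp_const k : MemLp (fun _ => k) 2 intervalMeasure).coeFn_toLp] with x hx
  rw [constL2, hx]

lemma primitive_constL2_neg_one (k : Vec 𝕜 n) : primitive 0 (constL2 k) (-1) = -k := by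
  rw [primitive, constL2, intervalIntegral_congr_L2 (memLp_const k).coeFn_toLp (by simp)]
  simp

end Data

/-! ### The decomposition of `F`, the resolvent equations and the two bounds. -/

namespace System

variable {𝕜 : Type*} [RCLike 𝕜] {n : ℕ} (S : System 𝕜 n)

/-- `A₂ * b`. -/
noncomputable def conv₂ (b : L2 𝕜 n) : L2 𝕜 n :=
  convL2 (fun θ => act (S.A₂ θ)) (memLp_act S.memLp_A₂) b

/-- `A₃ * b`. -/
noncomputable def conv₃ (b : L2 𝕜 n) : L2 𝕜 n :=
  convL2 (fun θ => act (S.A₃ θ)) (memLp_act S.memLp_A₃) b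

/-- `∫_{-1}^0 A₂(θ) b(θ) dθ`. -/
noncomputable def int₂ (b : L2 𝕜 n) : Vec 𝕜 n := ∫ θ, act (S.A₂ θ) (b θ) ∂intervalMeasure

lemma rL2_eq (z : H1 𝕜 n) :
    S.rL2 z = reflL2 (H1.deriv z) + S.conv₂ (H1.deriv z) + S.conv₃ z := by
  refine Lp.ext ?_
  filter_upwards [(S.memLp_rFun z).coeFn_toLp, ae_restrict_mem measurableSet_Ioo,
    Lp.coeFn_add (reflL2 (H1.deriv z) + S.conv₂ (H1.deriv z)) (S.conv₃ z),
    Lp.coeFn_add (reflL2 (H1.deriv z)) (S.conv₂ (H1.deriv z)), coeFn_reflL2 (H1.deriv z),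
    coeFn_convL2 (memLp_act S.memLp_A₂) (H1.deriv z),
    coeFn_convL2 (memLp_act S.memLp_A₃) (z : L2 𝕜 n)] with θ h1 hθ h2 h3 h4 h5 h6
  rw [h2, Pi.add_apply, h3, Pi.add_apply, h4, conv₂, h5, conv₃, h6]
  refine h1.trans ?_
  rw [S.rFun_eq z (Ioo_subset_Icc_self hθ), add_assoc]

/-- The derivative of `z(-1 - ·) + A₂ * z`, for `z ∈ H¹`. -/
noncomputable def derivG (z : H1 𝕜 n) : L2 𝕜 n :=
  -S.rL2 z + mulL2 S.A₂ S.memLp_A₂ (H1.evalNegOne z) + S.conv₃ z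

lemma derivG_eq (z : H1 𝕜 n) : S.derivG z = -(reflL2 (H1.deriv z) + S.conv₂ (H1.deriv z)) +
    mulL2 S.A₂ S.memLp_A₂ (H1.evalNegOne z) := by
  rw [derivG, rL2_eq]
  abel

lemma coe_ae_eq_primitive (z : H1 𝕜 n) :
    (z : L2 𝕜 n) =ᵐ[intervalMeasure] primitive (H1.data z).1 (H1.data z).2 := by
  have h := coeFn_primitiveL2 (H1.data z)
  rwa [primitiveL2_data] at h

lemma primitive_derivG (z : H1 𝕜 n) {θ : ℝ} (hθ : θ ∈ Icc (-1 : ℝ) 0) :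
    primitive (H1.evalNegOne z) (S.derivG z) θ =
      primitive (H1.data z).1 (H1.data z).2 (-1 - θ) +
        ∫ τ in (0 : ℝ)..θ, act (S.A₂ τ) ((z : L2 𝕜 n) (τ - θ - 1)) := by
  rw [derivG_eq, conv_congr (coe_ae_eq_primitive z) hθ]
  exact primitive_reflect_add_conv S.memLp_A₂ (H1.data z).1 (H1.data z).2 hθ

/-- Although `A₂` is only square integrable, the sum belongs to `H¹`: in the convolution the
derivative falls on `z`. -/
lemma reflL2_add_conv₂ (z : H1 𝕜 n) :
    reflL2 (z : L2 𝕜 n) + S.conv₂ z = primitiveL2 (H1.evalNegOne z, S.derivG z) := by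
  refine Lp.ext ?_
  filter_upwards [ae_restrict_mem measurableSet_Ioo, Lp.coeFn_add (reflL2 (z : L2 𝕜 n)) (S.conv₂ z),
    coeFn_reflL2 (z : L2 𝕜 n), coeFn_convL2 (memLp_act S.memLp_A₂) (z : L2 𝕜 n),
    coeFn_primitiveL2 (H1.evalNegOne z, S.derivG z), reflect_congr (coe_ae_eq_primitive z)]
    with θ hθ h1 h2 h3 h4 h5
  rw [h1, Pi.add_apply, h2, conv₂, h3, h4, S.primitive_derivG z (Ioo_subset_Icc_self hθ), h5]

/-- At `θ = -1` the shift `τ - θ - 1` is `τ`, so the convolution reduces to `-∫ A₂ z`. -/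
lemma primitive_derivG_neg_one (z : H1 𝕜 n) :
    primitive (H1.evalNegOne z) (S.derivG z) (-1) = H1.evalZero z - S.int₂ z := by
  rw [S.primitive_derivG z (by simp), H1.evalZero_eq, intervalIntegral.integral_symm,
    intervalIntegral.integral_of_le (by norm_num), integral_Ioc_eq_integral_Ioo, int₂]
  simp [primitive, sub_eq_add_neg]

/-- The vector `v - ∫_{-1}^0 A₂(θ) z(θ) dθ`. -/
noncomputable def kVec (x : M2 𝕜 n) : Vec 𝕜 n := x.fst - S.int₂ x.snd

/-- The function `z(-1 - θ) + (A₂ * z)(θ) + θ k`. -/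
noncomputable def gFun (x : M2 𝕜 n) : L2 𝕜 n :=
  reflL2 x.snd + S.conv₂ x.snd + primitiveL2 (0, constL2 (S.kVec x))

/-- The element `(0, g)` of `D(Ã)`. -/
noncomputable def gVec (x : M2 𝕜 n) : M2 𝕜 n := WithLp.toLp 2 (0, S.gFun x)

/-- The element `f` such that `F x = f - (λ - Ã) (0, g)`. -/
noncomputable def fVec (lam : 𝕜) (x : M2 𝕜 n) : M2 𝕜 n :=
  WithLp.toLp 2 (0, lam • S.gFun x + constL2 (S.kVec x) + S.conv₃ x.snd)

lemma gFun_eq (x : S.domA) : S.gFun x =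
    primitiveL2 (H1.evalNegOne (S.history x),
      S.derivG (S.history x) + constL2 (S.kVec x)) := by
  have h := S.reflL2_add_conv₂ (S.history x)
  change reflL2 (x : M2 𝕜 n).snd + S.conv₂ (x : M2 𝕜 n).snd = _ at h
  rw [gFun, h, ← map_add, Prod.mk_add_mk, add_zero]

lemma rMap_gVec (x : M2 𝕜 n) : S.rMap (S.gVec x) = S.gFun x := by
  change S.gFun x + mulL2 S.A₂ S.memLp_A₂ 0 = S.gFun x
  rw [map_zero, add_zero]

/-- The correction `θ k` is chosen for the boundary condition: it leaves `g(0) = z(-1)` unchanged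
and gives `g(-1) = z(0) - ∫ A₂ z - k = z(0) - v`, which is `A₁ z(-1)` because `(v, z) ∈ D(A)`. -/
lemma exists_gVec_mem (x : S.domA) : ∃ h : S.gVec x ∈ S.domTilde,
    H1.data (S.rH1 ⟨S.gVec x, h⟩) = (H1.evalNegOne (S.history x),
      S.derivG (S.history x) + constL2 (S.kVec x)) := by
  have hr : S.rMap (S.gVec x) = primitiveL2 (H1.evalNegOne (S.history x),
      S.derivG (S.history x) + constL2 (S.kVec x)) := (S.rMap_gVec x).trans (S.gFun_eq x)
  have hmem : S.rMap (S.gVec x) ∈ H1 𝕜 n := ⟨_, hr.symm⟩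
  have hdata := H1.data_eq (z := ⟨S.rMap (S.gVec x), hmem⟩) hr
  refine ⟨⟨hmem, ?_⟩, hdata⟩
  rw [H1.evalZero_eq]
  change _ = primitive (H1.data ⟨S.rMap (S.gVec x), hmem⟩).1
    (H1.data ⟨S.rMap (S.gVec x), hmem⟩).2 (-1)
  rw [hdata]
  have h1 := primitive_add (H1.evalNegOne (S.history x)) 0 (S.derivG (S.history x))
    (constL2 (S.kVec x)) (θ := -1) (by simp)
  rw [add_zero, primitive_constL2_neg_one, primitive_derivG_neg_one] at h1
  have h2 : (x : M2 𝕜 n).fst = H1.evalZero (S.history x) -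
    act S.A₁ (H1.evalNegOne (S.history x)) := x.2.2
  simp only
  rw [h1, kVec, h2]
  change _ = _ - S.int₂ (x : M2 𝕜 n).snd + _
  abel

/-- `Ã(0, g) = (z(-1), -g')` has the first component of `F x`, and its second component differs from
that of `F x` only by `k + A₃ * z`, which contains no derivative. -/
lemma F_eq (lam : 𝕜) (x : S.domA) : ∃ h : S.gVec x ∈ S.opTilde.domain,
    S.F x = S.fVec lam x - (lam • S.gVec x - S.opTilde ⟨S.gVec x, h⟩) := by
  obtain ⟨h, hdata⟩ := S.exists_gVec_mem x
  refine ⟨h, ?_⟩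
  have hop : S.opTilde ⟨S.gVec x, h⟩ = WithLp.toLp 2 (H1.evalNegOne (S.history x),
      -(S.derivG (S.history x) + constL2 (S.kVec x))) := by
    change WithLp.toLp 2 (H1.evalZero (S.rH1 ⟨S.gVec x, h⟩), -(H1.data (S.rH1 ⟨S.gVec x, h⟩)).2 +
      mulL2 S.A₃ S.memLp_A₃ 0) = _
    rw [H1.evalZero_eq, hdata, map_zero, add_zero]
  rw [hop]
  change WithLp.toLp 2 (_, _) = WithLp.toLp 2 (0 - (lam • 0 - _), _ - (lam • _ - _))
  congr 2
  · simp
  · change _ = lam • S.gFun x + constL2 (S.kVec x) + S.conv₃ (S.history x : L2 𝕜 n) -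
      (lam • S.gFun x - -(S.derivG (S.history x) + constL2 (S.kVec x)))
    rw [derivG]
    abel

lemma resolvent_F {lam : 𝕜} {R : M2 𝕜 n →L[𝕜] M2 𝕜 n} (hR : IsResolventAt S.opTilde lam R)
    (x : S.domA) : R (S.F x) = R (S.fVec lam x) - S.gVec x := by
  obtain ⟨h, hF⟩ := S.F_eq lam x
  have h2 := hR.2 ⟨S.gVec x, h⟩
  rw [hF, map_sub, h2]

/-- The equations satisfied by `(u, η) = (λ - Ã)⁻¹ f - (0, g)`. -/
lemma resolvent_equations {lam : 𝕜} {R : M2 𝕜 n →L[𝕜] M2 𝕜 n}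
    (hR : IsResolventAt S.opTilde lam R) (x : M2 𝕜 n) {y : M2 𝕜 n}
    (hy : y = R (S.fVec lam x) - S.gVec x) :
    y.snd + S.gFun x + mulL2 S.A₂ S.memLp_A₂ y.fst = primitiveL2 (lam • y.fst,
      -(lam • y.snd) + mulL2 S.A₃ S.memLp_A₃ y.fst + S.conv₃ x.snd + constL2 (S.kVec x)) ∧
    act S.A₁ (lam • y.fst) = primitive (lam • y.fst)
      (-(lam • y.snd) + mulL2 S.A₃ S.memLp_A₃ y.fst + S.conv₃ x.snd + constL2 (S.kVec x))
      (-1) := by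
  obtain ⟨h, hp⟩ := hR.1 (S.fVec lam x)
  set p := R (S.fVec lam x) with hpdef
  obtain ⟨hr, hbc⟩ := h
  -- `p = y + (0, g)`, so only the second components differ.
  have hu : y.fst = p.fst := by
    rw [hy]; change p.fst - 0 = p.fst; rw [sub_zero]
  have heta : y.snd = p.snd - S.gFun x := by rw [hy]; rfl
  set q : H1 𝕜 n := ⟨S.rMap p, hr⟩ with hq
  have hp' : lam • p - WithLp.toLp 2 (H1.evalZero q,
      -(H1.data q).2 + mulL2 S.A₃ S.memLp_A₃ p.fst) = S.fVec lam x := hp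
  have hfst : lam • p.fst - H1.evalZero q = 0 := congrArg (fun m : M2 𝕜 n => m.fst) hp'
  have hsnd : lam • p.snd - (-(H1.data q).2 + mulL2 S.A₃ S.memLp_A₃ p.fst) =
      lam • S.gFun x + constL2 (S.kVec x) + S.conv₃ x.snd :=
    congrArg (fun m : M2 𝕜 n => m.snd) hp'
  have hc : (H1.data q).1 = lam • y.fst := by
    rw [← H1.evalZero_eq, hu]; exact (sub_eq_zero.1 hfst).symm
  have hD : (H1.data q).2 = -(lam • y.snd) + mulL2 S.A₃ S.memLp_A₃ y.fst + S.conv₃ x.snd +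
      constL2 (S.kVec x) := by
    rw [heta, hu, smul_sub]
    have h3 : (H1.data q).2 = (lam • p.snd - (-(H1.data q).2 + mulL2 S.A₃ S.memLp_A₃ p.fst)) -
      lam • p.snd + mulL2 S.A₃ S.memLp_A₃ p.fst := by abel
    rw [h3, hsnd]
    abel
  rw [← hc, ← hD]
  refine ⟨?_, ?_⟩
  · rw [primitiveL2_data, heta, hu, sub_add_cancel]
    rfl
  · change _ = H1.evalNegOne q
    rw [← H1.evalZero_eq]
    exact hbc

lemma exists_norm_kVec_le : ∃ C, 0 ≤ C ∧ ∀ x : M2 𝕜 n, ‖S.kVec x‖ ≤ C * ‖x‖ := by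
  set a := √(∫ τ, ‖act (S.A₂ τ)‖ ^ 2 ∂intervalMeasure)
  refine ⟨1 + a, by positivity, fun x => ?_⟩
  have h := norm_integral_act_le (memLp_act S.memLp_A₂) x.snd
  have h1 := M2.norm_fst_le x
  have h2 : a * ‖x.snd‖ ≤ a * ‖x‖ := by gcongr; exact M2.norm_snd_le x
  refine (norm_sub_le _ _).trans ?_
  rw [int₂]
  linarith

lemma exists_norm_gFun_le : ∃ C, 0 ≤ C ∧ ∀ x : M2 𝕜 n, ‖S.gFun x‖ ≤ C * ‖x‖ := by
  obtain ⟨K, hK, hk⟩ := S.exists_norm_kVec_le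
  set a := √(∫ τ, ‖act (S.A₂ τ)‖ ^ 2 ∂intervalMeasure)
  refine ⟨1 + a + K, by positivity, fun x => ?_⟩
  have h1 : ‖reflL2 x.snd‖ ≤ ‖x‖ := by rw [norm_reflL2]; exact M2.norm_snd_le x
  have h2 : ‖S.conv₂ x.snd‖ ≤ a * ‖x‖ :=
    (norm_convL2_le _ _).trans (by gcongr; exact M2.norm_snd_le x)
  have h3 : ‖primitiveL2 (0, constL2 (S.kVec x))‖ ≤ K * ‖x‖ := by
    refine (norm_primitiveL2_le _ _).trans ?_
    rw [norm_zero, zero_add]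
    exact (norm_constL2_le _).trans (hk x)
  refine (norm_add₃_le).trans ?_
  linarith

lemma exists_norm_resolvent_F_le {lam : 𝕜} {R : M2 𝕜 n →L[𝕜] M2 𝕜 n}
    (hR : IsResolventAt S.opTilde lam R) :
    ∃ C, 0 ≤ C ∧ ∀ x : S.domA, ‖R (S.F x)‖ ≤ C * ‖(x : M2 𝕜 n)‖ := by
  obtain ⟨K, hK, hk⟩ := S.exists_norm_kVec_le
  obtain ⟨G, hG, hg⟩ := S.exists_norm_gFun_le
  set a := √(∫ τ, ‖act (S.A₃ τ)‖ ^ 2 ∂intervalMeasure)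
  refine ⟨‖R‖ * (‖lam‖ * G + K + a) + G, by positivity, fun x => ?_⟩
  have h1 : ‖S.gVec x‖ ≤ G * ‖(x : M2 𝕜 n)‖ := by
    refine (M2.norm_le _).trans ?_
    change ‖(0 : Vec 𝕜 n)‖ + ‖S.gFun x‖ ≤ _
    rw [norm_zero, zero_add]
    exact hg x
  have h2 : ‖S.fVec lam x‖ ≤ (‖lam‖ * G + K + a) * ‖(x : M2 𝕜 n)‖ := by
    refine (M2.norm_le _).trans ?_
    change ‖(0 : Vec 𝕜 n)‖ + ‖lam • S.gFun x + constL2 (S.kVec x) +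
      S.conv₃ (x : M2 𝕜 n).snd‖ ≤ _
    rw [norm_zero, zero_add]
    have e1 : ‖lam • S.gFun x‖ ≤ ‖lam‖ * (G * ‖(x : M2 𝕜 n)‖) := by
      rw [norm_smul]; gcongr; exact hg x
    have e2 := (norm_constL2_le (S.kVec x)).trans (hk x)
    have e3 : ‖S.conv₃ (x : M2 𝕜 n).snd‖ ≤ a * ‖(x : M2 𝕜 n)‖ :=
      (norm_convL2_le _ _).trans (by gcongr; exact M2.norm_snd_le _)
    refine (norm_add₃_le).trans ?_
    linarith
  rw [S.resolvent_F hR]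
  refine (norm_sub_le _ _).trans ?_
  have h3 : ‖R (S.fVec lam x)‖ ≤ ‖R‖ * ((‖lam‖ * G + K + a) * ‖(x : M2 𝕜 n)‖) :=
    (R.le_opNorm _).trans (by gcongr)
  linarith

/-- The resolvent equations are solved for `x` in the order `z`, `k`, `v`, each being bounded by `y
= R (F x)` and the quantities already bounded. -/
lemma exists_norm_le_resolvent_F {lam : 𝕜} {R : M2 𝕜 n →L[𝕜] M2 𝕜 n}
    (hR : IsResolventAt S.opTilde lam R) :
    ∃ C, 0 ≤ C ∧ ∀ x : S.domA, ‖(x : M2 𝕜 n)‖ ≤ C * ‖R (S.F x)‖ := by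
  obtain ⟨V, hV, hv⟩ := exists_norm_le_volterra (memLp_act S.memLp_A₂) (memLp_act S.memLp_A₃)
  obtain ⟨C₂, hC₂, hc₂⟩ := exists_norm_mulL2_le S.memLp_A₂
  obtain ⟨C₃, hC₃, hc₃⟩ := exists_norm_mulL2_le S.memLp_A₃
  set a₂ := √(∫ τ, ‖act (S.A₂ τ)‖ ^ 2 ∂intervalMeasure)
  set a₃ := √(∫ τ, ‖act (S.A₃ τ)‖ ^ 2 ∂intervalMeasure)
  set l := ‖lam‖
  set Z := V * (2 * l + C₃ + 1 + C₂) with hZ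
  have hl : 0 ≤ l := norm_nonneg _
  have hZ0 : 0 ≤ Z := by positivity
  set K := 2 * l + C₃ + a₃ * Z + ‖act S.A₁‖ * l with hK
  refine ⟨K + a₂ * Z + Z, by positivity, fun x' => ?_⟩
  obtain ⟨h1, h2⟩ := S.resolvent_equations hR x' (S.resolvent_F hR x')
  -- From here on only the two equations matter, not that `x` lies in `D(A)`.
  generalize (x' : M2 𝕜 n) = x at *
  generalize R (S.F x') = y at *
  have hu := M2.norm_fst_le y
  have hη := M2.norm_snd_le y
  set d := -(lam • y.snd) + mulL2 S.A₃ S.memLp_A₃ y.fst with hd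
  have nlu : ‖lam • y.fst‖ ≤ l * ‖y‖ := by rw [norm_smul]; gcongr
  have nd : ‖d‖ ≤ (l + C₃) * ‖y‖ := by
    refine (norm_add_le _ _).trans ?_
    rw [norm_neg, norm_smul, add_mul]
    exact add_le_add (by gcongr) ((hc₃ _).trans (by gcongr))
  -- The term `θ k` occurs both in `g` and in the integrated right side and cancels, so `z`
  -- satisfies an equation free of `k`.
  have hvol : reflL2 x.snd + S.conv₂ x.snd - primitiveL2 (0, S.conv₃ x.snd) =
      primitiveL2 (lam • y.fst, d) - y.snd - mulL2 S.A₂ S.memLp_A₂ y.fst := by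
    have e : (lam • y.fst, d + S.conv₃ x.snd + constL2 (S.kVec x)) =
        (lam • y.fst, d) + (0, S.conv₃ x.snd) + (0, constL2 (S.kVec x)) := by
      simp
    rw [e, map_add, map_add, gFun] at h1
    have h1' := eq_sub_of_add_eq h1
    rw [← add_assoc] at h1'
    have h1'' := eq_sub_of_add_eq h1'
    have h3 := eq_sub_of_add_eq' h1''
    rw [h3]
    abel
  have nz : ‖x.snd‖ ≤ Z * ‖y‖ := by
    refine (hv x.snd).trans ?_
    change V * ‖reflL2 x.snd + S.conv₂ x.snd - primitiveL2 (0, S.conv₃ x.snd)‖ ≤ _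
    rw [hvol, hZ, mul_assoc]
    refine mul_le_mul_of_nonneg_left ?_ hV
    have e1 := norm_primitiveL2_le (lam • y.fst) d
    have e2 : ‖mulL2 S.A₂ S.memLp_A₂ y.fst‖ ≤ C₂ * ‖y‖ := (hc₂ _).trans (by gcongr)
    refine ((norm_sub_le _ _).trans (add_le_add (norm_sub_le _ _) le_rfl)).trans ?_
    linarith
  have n3 : ‖S.conv₃ x.snd‖ ≤ a₃ * (Z * ‖y‖) :=
    (norm_convL2_le _ _).trans (by gcongr)
  -- The boundary condition at `-1`, where the primitive of the constant `k` equals `-k`, is solved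
  -- for `k`.
  have hkeq : S.kVec x = primitive (lam • y.fst) (d + S.conv₃ x.snd) (-1) -
      act S.A₁ (lam • y.fst) := by
    have e := primitive_add (lam • y.fst) 0 (d + S.conv₃ x.snd) (constL2 (S.kVec x)) (θ := -1)
      (by simp)
    rw [add_zero, primitive_constL2_neg_one, ← h2] at e
    rw [e]
    abel
  have nk : ‖S.kVec x‖ ≤ K * ‖y‖ := by
    rw [hkeq]
    have e1 := norm_primitive_le (lam • y.fst) (d + S.conv₃ x.snd) (θ := -1) (by simp)
    have e2 := norm_add_le d (S.conv₃ x.snd)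
    have e3 : ‖act S.A₁ (lam • y.fst)‖ ≤ ‖act S.A₁‖ * (l * ‖y‖) :=
      ((act S.A₁).le_opNorm _).trans (by gcongr)
    refine (norm_sub_le _ _).trans ?_
    rw [hK]
    linarith
  have nv : ‖x.fst‖ ≤ K * ‖y‖ + a₂ * (Z * ‖y‖) := by
    have e1 : x.fst = S.kVec x + S.int₂ x.snd := by rw [kVec, sub_add_cancel]
    have e2 : ‖S.int₂ x.snd‖ ≤ a₂ * (Z * ‖y‖) :=
      (norm_integral_act_le (memLp_act S.memLp_A₂) x.snd).trans (by gcongr)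
    rw [e1]
    exact (norm_add_le _ _).trans (add_le_add nk e2)
  refine (M2.norm_le x).trans ?_
  linarith

end System

end NeutralDelay

theorem mainTheorem7 {𝕜 : Type*} [RCLike 𝕜] {n : ℕ} (S : NeutralDelay.System 𝕜 n) (lam : 𝕜)
    (hlam : lam ∉ NeutralDelay.opSpectrum S.opTilde) :
    ∃ c C : ℝ, 0 < c ∧ 0 < C ∧ ∀ x : S.opA.domain,
      c * ‖(x : NeutralDelay.M2 𝕜 n)‖ ≤ ‖NeutralDelay.resolventOp S.opTilde lam (S.F x)‖ ∧
        ‖NeutralDelay.resolventOp S.opTilde lam (S.F x)‖ ≤ C * ‖(x : NeutralDelay.M2 𝕜 n)‖ := by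
  have hR := NeutralDelay.isResolventAt_resolventOp hlam
  obtain ⟨C, hC, hupper⟩ := S.exists_norm_resolvent_F_le hR
  obtain ⟨D, hD, hlower⟩ := S.exists_norm_le_resolvent_F hR
  -- `C` and `D` are only known to be nonnegative; adding one makes the constants strictly positive.
  refine ⟨(D + 1)⁻¹, C + 1, by positivity, by positivity, fun x => ⟨?_, ?_⟩⟩
  · rw [inv_mul_le_iff₀ (by positivity)]
    exact (hlower x).trans (by gcongr; linarith)
  · exact (hupper x).trans (by gcongr; linarith)
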